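/- **The distributed model.** Let $G$ be a graph with vertex set $\{1,\dots,m\}$ whose vertices are called nodes. In the $(n_c,n_q,R,E)$ model with $m$ nodes on $G$, each node holds one copy of an unknown $n$-qubit state $\rho$ and, for each of its neighbours in $G$, its halves of $E$ Bell pairs $\frac{1}{\sqrt2}(|00\rangle+|11\rangle)$ shared with that neighbour. Every node applies an arbitrary quantum instrument to the qubits it holds and sends $n_c$ classical bits and $n_q$ qubits to a central node. No other communication takes place. The central node applies a measurement to what it received and outputs "pure" or "maximally mixed". If $R=\mathsf{public}$, all instruments and the central measurement may depend on a shared random seed (drawn from any probability space); if $R=\mathsf{private}$, the parties have only independent private randomness. For $0<\delta<\frac12$, we say that $m$ nodes on $G$ *can test purity with error $\delta$* in this model if there is such a protocol that outputs "pure" with probability at least $1-\delta$ whenever $\rho=|\psi\rangle\langle\psi|$ is a pure state, and outputs "maximally mixed" with probability at least $1-\delta$ when $\rho=\mathbb 1/2^n$. **Corollary (exponential separation from shared entanglement).** Let $0<\delta<\frac12$. 1. There is a constant $C>0$, depending only on $\delta$, such that for all $n\ge 1$, all $n_c>0$, all $m$ and every graph $G$ on $m$ nodes: if $m$ nodes on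 $G$ can test purity of $n$-qubit states with error $\delta$ in the $(n_c,\,n_q=0,\,R=\mathsf{public},\,E=0)$ model, then $m\ge C\,2^{n/2}$. That is, $\Omega(2^{n/2})$ nodes are needed, however large $n_c$ is. 2. There is a constant $m_0$, depending only on $\delta$, such that for all $n\ge 1$, all $m$ and every graph $G$ on $m$ nodes that has a matching covering at least $m_0$ nodes (for instance, a path with $m_0$ nodes if $m_0$ is even), $m$ nodes on $G$ can test purity of $n$-qubit states with error $\delta$ in the $(n_c=2n,\,n_q=0,\,R=\mathsf{private},\,E=n)$ model. In particular, $O(1)$ nodes suffice. -/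

import Mathlib

open MeasureTheory Matrix
open scoped ComplexOrder

/-! ### States of qubit registers -/

/-- The computational basis of a register of `k` qubits. -/
abbrev Bits (k : ℕ) : Type := Fin k → Bool

/-- `ρ` is a pure `n`-qubit state: `ρ = |ψ⟩⟨ψ|` for a unit vector `ψ`. -/
def IsPureState {n : ℕ} (ρ : Matrix (Bits n) (Bits n) ℂ) : Prop :=
  ∃ ψ : Bits n → ℂ, ∑ x, ‖ψ x‖ ^ 2 = 1 ∧ ρ = vecMulVec ψ (star ψ)

/-- The maximally mixed `n`-qubit state `1 / 2 ^ n`. -/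
noncomputable def maximallyMixed (n : ℕ) : Matrix (Bits n) (Bits n) ℂ :=
  ((2 : ℂ) ^ n)⁻¹ • (1 : Matrix (Bits n) (Bits n) ℂ)

/-- The tensor product of a finite family of matrices. -/
def tensorFamily {ι : Type} [Fintype ι] {α β : ι → Type} (A : ∀ i, Matrix (α i) (β i) ℂ) :
    Matrix (∀ i, α i) (∀ i, β i) ℂ :=
  Matrix.of fun x y => ∏ i, A i (x i) (y i)

/-! ### The initial joint state of the nodes -/

/-- The basis of the part of the shared entanglement that node `i` holds: `E` qubits for each of
its neighbours in the graph `G`. -/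
abbrev EntReg {m : ℕ} (G : SimpleGraph (Fin m)) (E : ℕ) (i : Fin m) : Type :=
  {j : Fin m // G.Adj i j} → Bits E

/-- The basis of the whole register of node `i`: the `n` qubits of its copy of the unknown state,
and its halves of the Bell pairs. -/
abbrev NodeReg {m : ℕ} (n : ℕ) (G : SimpleGraph (Fin m)) (E : ℕ) (i : Fin m) : Type :=
  Bits n × EntReg G E i

/-- The amplitude `⟨a, b | EPR_E⟩` of `E` Bell pairs, `|EPR_E⟩ = 2 ^ (-E / 2) ∑ k, |k, k⟩`. -/
noncomputable def bellAmplitude {E : ℕ} (a b : Bits E) : ℂ :=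
  if a = b then (((Real.sqrt 2)⁻¹ : ℝ) : ℂ) ^ E else 0

/-- The amplitude, at the basis vector `s`, of the shared entanglement: `E` Bell pairs for each edge
of `G`. The edge `{i, j}` is listed once, as the pair with `i < j`. -/
noncomputable def entAmplitude {m : ℕ} (G : SimpleGraph (Fin m)) [DecidableRel G.Adj] (E : ℕ)
    (s : ∀ i, EntReg G E i) : ℂ :=
  ∏ e : {e : Fin m × Fin m // e.1 < e.2 ∧ G.Adj e.1 e.2},
    bellAmplitude (s e.1.1 ⟨e.1.2, e.2.2⟩) (s e.1.2 ⟨e.1.1, e.2.2.symm⟩)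

/-- The initial joint state: one copy of `ρ` at every node, and `E` Bell pairs shared by each pair of
neighbouring nodes. -/
noncomputable def initialState {n m : ℕ} (G : SimpleGraph (Fin m)) [DecidableRel G.Adj] (E : ℕ)
    (ρ : Matrix (Bits n) (Bits n) ℂ) :
    Matrix (∀ i, NodeReg n G E i) (∀ i, NodeReg n G E i) ℂ :=
  Matrix.of fun x y =>
    (∏ i, ρ (x i).1 (y i).1) *
      (entAmplitude G E (fun i => (x i).2) * star (entAmplitude G E (fun i => (y i).2)))

/-! ### The distributed model -/

/-- Whether the parties share a public source of randomness, or have private sources only. -/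
inductive Coins : Type
  | pub
  | priv

/-- A two-outcome (accept / reject) protocol with `m` nodes on the vertices of `G`, each holding one
copy of an `n`-qubit state, in the `(nc, nq, R, E)` model.

Given the public random seed `r`, node `i` applies an arbitrary quantum instrument to its own
register, with classical outcome in `{0,1}^nc` and quantum output of `nq` qubits; it is given by
Kraus operators `node r i c k` (`c` is the classical message, `k` is discarded). Both messages are
sent to the central node, which applies an arbitrary two-outcome measurement, with the operator
`accept r c` for the outcome "accept", to the qubits it received, depending on the classical
messages `c`. Nothing else is communicated. Private randomness needs no separate seed, because a
mixture of instruments (or of measurements) is again one; so with private coins only, the public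
seed is trivial. -/
structure Protocol (n m : ℕ) (G : SimpleGraph (Fin m)) [DecidableRel G.Adj]
    (nc nq : ℕ) (R : Coins) (E : ℕ) where
  Seed : Type
  [seedMeasurableSpace : MeasurableSpace Seed]
  coin : Measure Seed
  [coin_isProbabilityMeasure : IsProbabilityMeasure coin]
  seed_trivial : R = Coins.priv → Subsingleton Seed
  Env : Fin m → Type
  [envFintype : ∀ i, Fintype (Env i)]
  node : Seed → ∀ i, Bits nc → Env i → Matrix (Bits nq) (NodeReg n G E i) ℂ
  node_measurable : ∀ i c k a b, Measurable fun r => node r i c k a b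
  node_complete : ∀ r i, ∑ c, ∑ k, (node r i c k)ᴴ * node r i c k = 1
  accept : Seed → (Fin m → Bits nc) → Matrix (Fin m → Bits nq) (Fin m → Bits nq) ℂ
  accept_measurable : ∀ c a b, Measurable fun r => accept r c a b
  accept_posSemidef : ∀ r c, (accept r c).PosSemidef
  one_sub_accept_posSemidef : ∀ r c, (1 - accept r c).PosSemidef

attribute [instance] Protocol.seedMeasurableSpace Protocol.coin_isProbabilityMeasure
  Protocol.envFintype

namespace Protocol

variable {n m : ℕ} {G : SimpleGraph (Fin m)} [DecidableRel G.Adj] {nc nq : ℕ} {R : Coins} {E : ℕ}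

/-- For the seed `r`, the unnormalized state of the qubits that the central node receives together
with the classical messages `c`; its trace is the probability of `c`. -/
noncomputable def messageState (P : Protocol n m G nc nq R E) (ρ : Matrix (Bits n) (Bits n) ℂ)
    (r : P.Seed) (c : Fin m → Bits nc) : Matrix (Fin m → Bits nq) (Fin m → Bits nq) ℂ :=
  ∑ k : (∀ i, P.Env i),
    tensorFamily (fun i => P.node r i (c i) (k i)) * initialState G E ρ *
      (tensorFamily (fun i => P.node r i (c i) (k i)))ᴴ

/-- The probability that the central node accepts, when every node gets a copy of `ρ`. -/
noncomputable def acceptProb (P : Protocol n m G nc nq R E) (ρ : Matrix (Bits n) (Bits n) ℂ) : ℝ :=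
  ∫ r, (∑ c, (P.accept r c * P.messageState ρ r c).trace).re ∂P.coin

/-- The protocol tests with error probability at most `δ` whether the unknown state is pure (accept)
or maximally mixed (reject). -/
def TestsPureVsMixed (P : Protocol n m G nc nq R E) (δ : ℝ) : Prop :=
  (∀ ρ : Matrix (Bits n) (Bits n) ℂ, IsPureState ρ → 1 - δ ≤ P.acceptProb ρ) ∧
    1 - δ ≤ 1 - P.acceptProb (maximallyMixed n)

end Protocol

/-- In the `(nc, nq, R, E)` model, `m` nodes on the vertices of `G` can test with error probability
at most `δ` whether an unknown `n`-qubit state is pure or maximally mixed. -/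
def PureVsMixedSolvable (δ : ℝ) (n m : ℕ) (G : SimpleGraph (Fin m)) [DecidableRel G.Adj]
    (nc nq : ℕ) (R : Coins) (E : ℕ) : Prop :=
  ∃ P : Protocol n m G nc nq R E, P.TestsPureVsMixed δ

/-! Lower bound. With no quantum messages each Kraus operator is a row vector, and with no
entanglement a joint outcome has amplitude `∏ ⟨l i, φ i⟩`, a product of linear forms in the local
inputs. Summed over all basis inputs its squared modulus gives `∏ ‖l i‖²`, which is the maximally
mixed case up to the factor `2 ^ (n * m)`. On equal pure inputs the state is replaced by an
unnormalized complex Gaussian vector `g`. Multiplication by a linear form is a creation operator on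
Fock space, so it expands norms by at least `‖l‖`, and hence `E ∏ |l i (g)|² ≥ ∏ ‖l i‖²`
(`prod_le_integral_prod_linear`). Applied to the outcomes that lead to rejection, with `d = 2 ^ n`,
this yields `(1 - δ) d ^ m ≤ E[reject at g] ≤ δ E ‖g‖ ^ (2 m) = δ ∏_{i < m} (d + i)`
(`Protocol.one_sub_mul_pow_le`). The middle step uses that rejection is homogeneous in `g`, and
Fubini to exchange the public seed with `g`. As the product is at most `d ^ m exp (m² / d)`, it
follows that `m² ≥ d log ((1 - δ) / δ)`. The number of messages never enters.

Upper bound. Two matched nodes Bell-measure their copies against the halves of their `n` shared Bell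
pairs. By entanglement swapping this projects the two copies onto a Bell state labelled by the sum
`(v, u)` of the two outcomes, which is symmetric or antisymmetric under exchange according to the
sign `(-1) ^ (v · u)`. Two equal pure states are exchange symmetric and never give an antisymmetric
outcome (`outcomeAmplitude_bellRow_eq_zero`). On maximally mixed inputs all outcomes are uniform,
and a pair looks symmetric with probability `(1 + 2 ^ (-n)) / 2 ≤ 3 / 4`, independently of the other
pairs (`sum_allSymmetric_le`). So a number of pairs depending only on `δ` suffices. -/

/-! ### The standard complex Gaussian variable -/

/-- The standard exponential distribution. -/
noncomputable def stdExponential : Measure ℝ :=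
  (volume.restrict (Set.Ioi 0)).withDensity fun x => ENNReal.ofReal (Real.exp (-x))

theorem integrable_pow_stdExponential (a : ℕ) :
    Integrable (fun x : ℝ => x ^ a) stdExponential := by
  have hG := Real.GammaIntegral_convergent (s := (a : ℝ) + 1) (by positivity)
  rw [stdExponential, integrable_withDensity_iff_integrable_smul₀' (by fun_prop) (by simp)]
  refine hG.congr ?_
  filter_upwards [ae_restrict_mem measurableSet_Ioi] with x _
  simp [ENNReal.toReal_ofReal (Real.exp_pos _).le]

theorem integral_pow_stdExponential (a : ℕ) :
    ∫ x : ℝ, x ^ a ∂stdExponential = (a.factorial : ℝ) := by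
  rw [← Real.Gamma_nat_eq_factorial, Real.Gamma_eq_integral (by positivity), stdExponential,
    integral_withDensity_eq_integral_toReal_smul (by fun_prop) (by simp)]
  simp [ENNReal.toReal_ofReal (Real.exp_pos _).le]

instance : IsProbabilityMeasure stdExponential := by
  have h0 : Integrable (fun _ : ℝ => (1 : ℝ)) stdExponential := by
    simpa using integrable_pow_stdExponential 0
  have : IsFiniteMeasure stdExponential := by
    simpa [integrable_const_iff] using h0
  have h1 := integral_pow_stdExponential 0
  simp only [pow_zero, integral_const, smul_eq_mul, mul_one, Nat.factorial_zero,
    Nat.cast_one] at h1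
  exact ⟨by simpa [Measure.real, ENNReal.toReal_eq_one_iff] using h1⟩

/-- The uniform distribution on the unit interval. -/
noncomputable def stdUniform : Measure ℝ := volume.restrict (Set.Ioc 0 1)

instance : IsProbabilityMeasure stdUniform := ⟨by simp [stdUniform]⟩

theorem integral_exp_int_mul_stdUniform (k : ℤ) :
    ∫ t : ℝ, Complex.exp (2 * Real.pi * Complex.I * k * t) ∂stdUniform = if k = 0 then 1 else 0 := by
  split_ifs with h
  · simp [h]
  · rw [stdUniform, ← intervalIntegral.integral_of_le zero_le_one,
      integral_exp_mul_complex (by simp [h, Real.pi_ne_zero])]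
    have := Complex.exp_int_mul_two_pi_mul_I k
    rw [show (2 * Real.pi * Complex.I * k * (1 : ℝ) : ℂ) = k * (2 * Real.pi * Complex.I) by
      push_cast; ring, this]
    simp

/-- The complex number with squared modulus `p.1` and argument `2 π p.2`. -/
noncomputable def polarPoint (p : ℝ × ℝ) : ℂ :=
  (Real.sqrt p.1 : ℂ) * Complex.exp (2 * Real.pi * Complex.I * p.2)

theorem measurable_polarPoint : Measurable polarPoint := by
  unfold polarPoint
  fun_prop

theorem polarPoint_pow_mul (p : ℝ × ℝ) (a b : ℕ) :
    polarPoint p ^ a * star (polarPoint p) ^ b =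
      ((Real.sqrt p.1 ^ (a + b) : ℝ) : ℂ) *
        Complex.exp (2 * Real.pi * Complex.I * ((a : ℤ) - b : ℤ) * p.2) := by
  have h : star (polarPoint p) =
      (Real.sqrt p.1 : ℂ) * Complex.exp (-(2 * Real.pi * Complex.I * p.2)) := by
    simp [polarPoint, ← Complex.exp_conj, Complex.conj_ofNat]
  rw [h, polarPoint, mul_pow, mul_pow, ← Complex.exp_nat_mul, ← Complex.exp_nat_mul]
  rw [show (2 * Real.pi * Complex.I * ((a : ℤ) - b : ℤ) * p.2 : ℂ) =
    a * (2 * Real.pi * Complex.I * p.2) + b * (-(2 * Real.pi * Complex.I * p.2)) by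
      push_cast; ring, Complex.exp_add]
  push_cast
  ring

/-- The standard complex Gaussian distribution. -/
noncomputable def stdComplexGaussian : Measure ℂ :=
  (stdExponential.prod stdUniform).map polarPoint

instance : IsProbabilityMeasure stdComplexGaussian :=
  Measure.isProbabilityMeasure_map measurable_polarPoint.aemeasurable

theorem integrable_exp_int_mul_stdUniform (k : ℤ) :
    Integrable (fun t : ℝ => Complex.exp (2 * Real.pi * Complex.I * k * t)) stdUniform := by
  have : IntegrableOn (fun t : ℝ => Complex.exp (2 * Real.pi * Complex.I * k * t))
      (Set.Ioc 0 1) := by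
    refine (Continuous.integrableOn_Icc ?_).mono_set Set.Ioc_subset_Icc_self
    fun_prop
  exact this

theorem integrable_sqrt_pow_stdExponential (a : ℕ) :
    Integrable (fun x : ℝ => ((Real.sqrt x ^ a : ℝ) : ℂ)) stdExponential := by
  suffices h : Integrable (fun x : ℝ => Real.sqrt x ^ a) stdExponential from h.ofReal
  -- Domination by `1 + x ^ a`: the bound `1` serves for `x ≤ 1`, and `√x ≤ x` beyond.
  refine ((integrable_const (1 : ℝ)).add (integrable_pow_stdExponential a)).mono'
    (by fun_prop) ?_
  have : ∀ᵐ x ∂stdExponential, x ∈ Set.Ioi (0 : ℝ) :=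
    (withDensity_absolutelyContinuous _ _).ae_le (ae_restrict_mem measurableSet_Ioi)
  filter_upwards [this] with x hx
  have hx' : (0 : ℝ) < x := hx
  rw [Real.norm_of_nonneg (by positivity)]
  simp only [Pi.add_apply]
  rcases le_total x 1 with h | h
  · have : Real.sqrt x ^ a ≤ 1 := pow_le_one₀ (by positivity) (Real.sqrt_le_one.2 h)
    have := pow_pos hx' a
    linarith
  · have h2 : Real.sqrt x ≤ x := by
      rw [Real.sqrt_le_left hx'.le]; nlinarith
    have := pow_le_pow_left₀ (Real.sqrt_nonneg x) h2 a
    linarith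

theorem integrable_pow_mul_stdComplexGaussian (a b : ℕ) :
    Integrable (fun z : ℂ => z ^ a * star z ^ b) stdComplexGaussian := by
  rw [stdComplexGaussian, integrable_map_measure (by fun_prop) measurable_polarPoint.aemeasurable]
  simp only [Function.comp_def, polarPoint_pow_mul]
  exact (integrable_sqrt_pow_stdExponential (a + b)).mul_prod
    (integrable_exp_int_mul_stdUniform ((a : ℤ) - b))

/-- In polar form the moment factors: the uniform phase kills `a ≠ b`, and for `a = b` the
exponential law of the squared modulus leaves a Gamma integral. -/
theorem integral_pow_mul_stdComplexGaussian (a b : ℕ) :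
    ∫ z : ℂ, z ^ a * star z ^ b ∂stdComplexGaussian =
      if a = b then (a.factorial : ℂ) else 0 := by
  rw [stdComplexGaussian, integral_map measurable_polarPoint.aemeasurable (by fun_prop)]
  simp only [polarPoint_pow_mul]
  rw [integral_prod_mul (fun x : ℝ => ((Real.sqrt x ^ (a + b) : ℝ) : ℂ))
    (fun t : ℝ => Complex.exp (2 * Real.pi * Complex.I * ((a : ℤ) - b : ℤ) * t)),
    integral_exp_int_mul_stdUniform]
  by_cases h : a = b
  · subst h
    have h1 : ∫ x : ℝ, ((Real.sqrt x ^ (a + a) : ℝ) : ℂ) ∂stdExponential = (a.factorial : ℂ) := by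
      rw [← Complex.ofReal_natCast, ← integral_pow_stdExponential a]
      refine (integral_ofReal (f := fun x : ℝ => Real.sqrt x ^ (a + a))).trans ?_
      congr 1
      refine integral_congr_ae ?_
      have : ∀ᵐ x ∂stdExponential, x ∈ Set.Ioi (0 : ℝ) :=
        (withDensity_absolutelyContinuous _ _).ae_le (ae_restrict_mem measurableSet_Ioi)
      filter_upwards [this] with x hx
      have hx' : (0 : ℝ) < x := hx
      rw [← two_mul, pow_mul, Real.sq_sqrt hx'.le]
    simpa using h1
  · have : ((a : ℤ) - b) ≠ 0 := by omega
    simp [h, this]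

/-! ### The Gaussian inner product of polynomials -/

section Fischer

open MvPolynomial

variable {σ : Type} [Fintype σ]

/-- The distribution of independent standard complex Gaussian variables. -/
noncomputable def gaussianVector (σ : Type) [Fintype σ] : Measure (σ → ℂ) :=
  Measure.pi fun _ => stdComplexGaussian

instance : IsProbabilityMeasure (gaussianVector σ) := by
  unfold gaussianVector; infer_instance

/-- The inner product of polynomials in `L²` of the Gaussian distribution, linear on the left. -/
noncomputable def fischer (p q : MvPolynomial σ ℂ) : ℂ :=
  ∫ g, eval g p * star (eval g q) ∂gaussianVector σ

theorem eval_monomial_mul_star (α β : σ →₀ ℕ) (a b : ℂ) (g : σ → ℂ) :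
    eval g (monomial α a) * star (eval g (monomial β b)) =
      a * star b * ∏ x, (g x ^ α x * star (g x) ^ β x) := by
  simp only [eval_monomial, Finsupp.prod_fintype _ _ (fun i => pow_zero (g i)),
    Finset.prod_mul_distrib, star_mul', star_prod, star_pow]
  ring

theorem integrable_eval_mul_star (p q : MvPolynomial σ ℂ) :
    Integrable (fun g => eval g p * star (eval g q)) (gaussianVector σ) := by
  induction p using MvPolynomial.induction_on' with
  | monomial α a =>
    induction q using MvPolynomial.induction_on' with
    | monomial β b =>
      simp only [eval_monomial_mul_star]
      exact (Integrable.fintype_prod fun x =>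
        integrable_pow_mul_stdComplexGaussian (α x) (β x)).const_mul _
    | add q₁ q₂ h₁ h₂ =>
      simp only [map_add, star_add, mul_add]
      exact h₁.add h₂
  | add p₁ p₂ h₁ h₂ =>
    simp only [map_add, add_mul]
    exact h₁.add h₂

theorem fischer_add_left (p₁ p₂ q : MvPolynomial σ ℂ) :
    fischer (p₁ + p₂) q = fischer p₁ q + fischer p₂ q := by
  simp only [fischer, map_add, add_mul]
  exact integral_add (integrable_eval_mul_star _ _) (integrable_eval_mul_star _ _)

theorem fischer_add_right (p q₁ q₂ : MvPolynomial σ ℂ) :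
    fischer p (q₁ + q₂) = fischer p q₁ + fischer p q₂ := by
  simp only [fischer, map_add, star_add, mul_add]
  exact integral_add (integrable_eval_mul_star _ _) (integrable_eval_mul_star _ _)

theorem fischer_sum_left {ι : Type*} (s : Finset ι) (p : ι → MvPolynomial σ ℂ)
    (q : MvPolynomial σ ℂ) : fischer (∑ i ∈ s, p i) q = ∑ i ∈ s, fischer (p i) q := by
  simp only [fischer, map_sum, Finset.sum_mul]
  exact integral_finsetSum _ fun i _ => integrable_eval_mul_star _ _

theorem fischer_sum_right {ι : Type*} (s : Finset ι) (p : MvPolynomial σ ℂ)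
    (q : ι → MvPolynomial σ ℂ) : fischer p (∑ i ∈ s, q i) = ∑ i ∈ s, fischer p (q i) := by
  simp only [fischer, map_sum, star_sum, Finset.mul_sum]
  exact integral_finsetSum _ fun i _ => integrable_eval_mul_star _ _

theorem fischer_C_mul_left (a : ℂ) (p q : MvPolynomial σ ℂ) :
    fischer (C a * p) q = a * fischer p q := by
  simp only [fischer, map_mul, eval_C, mul_assoc]
  exact integral_const_mul _ _

theorem fischer_C_mul_right (a : ℂ) (p q : MvPolynomial σ ℂ) :
    fischer p (C a * q) = star a * fischer p q := by
  simp only [fischer, map_mul, eval_C, star_mul', mul_left_comm _ (star a)]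
  exact integral_const_mul _ _

theorem fischer_sum_C_mul (l l' : σ → ℂ) (p q : σ → MvPolynomial σ ℂ) :
    fischer (∑ x, C (l x) * p x) (∑ y, C (l' y) * q y) =
      ∑ x, ∑ y, l x * star (l' y) * fischer (p x) (q y) := by
  rw [fischer_sum_left]
  refine Finset.sum_congr rfl fun x _ => ?_
  rw [fischer_sum_right]
  refine Finset.sum_congr rfl fun y _ => ?_
  rw [fischer_C_mul_left, fischer_C_mul_right, mul_assoc]

theorem fischer_self (p : MvPolynomial σ ℂ) :
    fischer p p = ((∫ g, ‖eval g p‖ ^ 2 ∂gaussianVector σ : ℝ) : ℂ) := by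
  refine Eq.trans ?_ (integral_ofReal (f := fun g => ‖eval g p‖ ^ 2))
  refine integral_congr_ae (Filter.Eventually.of_forall fun g => ?_)
  simp [Complex.mul_conj, Complex.normSq_eq_norm_sq]

theorem fischer_monomial (α β : σ →₀ ℕ) (a b : ℂ) :
    fischer (monomial α a) (monomial β b) =
      if α = β then a * star b * ∏ x, ((α x).factorial : ℂ) else 0 := by
  simp only [fischer, eval_monomial_mul_star]
  rw [integral_const_mul, gaussianVector,
    integral_fintype_prod_eq_prod (fun x (z : ℂ) => z ^ α x * star z ^ β x)]
  simp only [integral_pow_mul_stdComplexGaussian]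
  split_ifs with h
  · simp [h]
  · obtain ⟨x, hx⟩ : ∃ x, α x ≠ β x := by
      by_contra! hc
      exact h (Finsupp.ext hc)
    rw [Finset.prod_eq_zero (Finset.mem_univ x) (by simp [hx]), mul_zero]

/-- Creation and annihilation are adjoint: monomials are orthogonal with squared norm `α!`, and
raising one exponent multiplies that norm by the factor which `pderiv` brings down. -/
theorem fischer_X_mul (x : σ) (p q : MvPolynomial σ ℂ) :
    fischer (X x * p) q = fischer p (pderiv x q) := by
  classical
  induction p using MvPolynomial.induction_on' with
  | monomial α a =>
    induction q using MvPolynomial.induction_on' with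
    | monomial β b =>
      rw [X, monomial_mul, one_mul, pderiv_monomial, fischer_monomial, fischer_monomial]
      by_cases h : Finsupp.single x 1 + α = β
      · subst h
        rw [if_pos rfl, if_pos (by simp)]
        rw [← Finset.mul_prod_erase _ _ (Finset.mem_univ x),
          ← Finset.mul_prod_erase _ (fun y => ((α y).factorial : ℂ)) (Finset.mem_univ x)]
        have : ∀ y ∈ Finset.univ.erase x,
            ((((Finsupp.single x 1 + α : σ →₀ ℕ) y).factorial : ℕ) : ℂ) = ((α y).factorial : ℂ) := by
          intro y hy
          simp [Finsupp.single_eq_of_ne (Finset.ne_of_mem_erase hy)]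
        rw [Finset.prod_congr rfl this]
        simp only [Finsupp.add_apply, Finsupp.single_eq_same, add_comm 1, Nat.factorial_succ]
        push_cast
        simp
        ring
      · rw [if_neg h]
        split_ifs with h'
        · have : β x = 0 := by
            by_contra hb
            apply h
            subst h'
            ext y
            by_cases hy : y = x
            · subst hy; simp; omega
            · simp [Finsupp.single_eq_of_ne hy]
          simp [this]
        · rfl
    | add q₁ q₂ h₁ h₂ => rw [map_add, fischer_add_right, fischer_add_right, h₁, h₂]
  | add p₁ p₂ h₁ h₂ => rw [mul_add, fischer_add_left, fischer_add_left, h₁, h₂]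

theorem fischer_mul_X (x : σ) (p q : MvPolynomial σ ℂ) :
    fischer p (X x * q) = fischer (pderiv x p) q := by
  have h (p q : MvPolynomial σ ℂ) : fischer p q = star (fischer q p) := by
    simp only [fischer]
    rw [Complex.star_def, ← integral_conj]
    congr 1 with g
    simp [mul_comm]
  rw [h, fischer_X_mul, ← h]

/-- The canonical commutation relation, in the form of the Leibniz rule for `pderiv x (X y * p)`. -/
theorem fischer_X_mul_X_mul [DecidableEq σ] (x y : σ) (p : MvPolynomial σ ℂ) :
    fischer (X x * p) (X y * p) =
      (if x = y then fischer p p else 0) + fischer (pderiv y p) (pderiv x p) := by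
  rw [fischer_X_mul, Derivation.leibniz, smul_eq_mul, smul_eq_mul, fischer_add_right,
    fischer_mul_X, pderiv_X, add_comm, Pi.single_apply]
  split_ifs with h h' h'
  · rw [mul_one]
  · exact absurd h.symm h'
  · exact absurd h'.symm h
  · simp [fischer]

/-- Multiplication by a linear form is at least as expanding as its norm: creation operators on
Fock space satisfy `‖a†(l) p‖² = ‖l‖² ‖p‖² + ‖a(l) p‖²`. -/
theorem le_integral_linear_mul (l : σ → ℂ) (p : MvPolynomial σ ℂ) :
    (∑ x, ‖l x‖ ^ 2) * ∫ g, ‖eval g p‖ ^ 2 ∂gaussianVector σ ≤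
      ∫ g, ‖∑ x, l x * g x‖ ^ 2 * ‖eval g p‖ ^ 2 ∂gaussianVector σ := by
  classical
  -- The annihilation term `a(l) p`; its squared norm is exactly the excess, dropped at the end.
  set D : MvPolynomial σ ℂ := ∑ x, C (star (l x)) * pderiv x p with hD
  have key : fischer ((∑ x, C (l x) * X x) * p) ((∑ x, C (l x) * X x) * p) =
      (∑ x, ((‖l x‖ ^ 2 : ℝ) : ℂ)) * fischer p p + fischer D D := by
    have hl : (∑ x, C (l x) * X x) * p = ∑ x, C (l x) * (X x * p) := by
      simp only [Finset.sum_mul, mul_assoc]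
    rw [hl, hD, fischer_sum_C_mul, fischer_sum_C_mul]
    simp only [fischer_X_mul_X_mul, mul_add, Finset.sum_add_distrib, star_star, mul_ite, mul_zero,
      Finset.sum_ite_eq, Finset.mem_univ, if_true]
    congr 1
    · rw [Finset.sum_mul]
      refine Finset.sum_congr rfl fun x _ => ?_
      congr 1
      simp [Complex.mul_conj, Complex.normSq_eq_norm_sq]
    · rw [Finset.sum_comm]
      refine Finset.sum_congr rfl fun x _ => Finset.sum_congr rfl fun y _ => ?_
      rw [mul_comm (l y)]
  rw [fischer_self, fischer_self, fischer_self] at key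
  have key' : ∫ g, ‖eval g ((∑ x, C (l x) * X x) * p)‖ ^ 2 ∂gaussianVector σ =
      (∑ x, ‖l x‖ ^ 2) * ∫ g, ‖eval g p‖ ^ 2 ∂gaussianVector σ +
        ∫ g, ‖eval g D‖ ^ 2 ∂gaussianVector σ := by exact_mod_cast key
  have hpos : 0 ≤ ∫ g, ‖eval g D‖ ^ 2 ∂gaussianVector σ :=
    integral_nonneg fun g => by positivity
  have hev : ∀ g : σ → ℂ, ‖eval g ((∑ x, C (l x) * X x) * p)‖ ^ 2 =
      ‖∑ x, l x * g x‖ ^ 2 * ‖eval g p‖ ^ 2 := by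
    intro g
    simp [mul_pow]
  simp only [hev] at key'
  linarith

/-- For linear forms `l i`, the Gaussian mean of `∏ |l i|²` is at least the product of the means. -/
theorem prod_le_integral_prod_linear {ι : Type*} (s : Finset ι) (l : ι → σ → ℂ) :
    ∏ i ∈ s, ∑ x, ‖l i x‖ ^ 2 ≤
      ∫ g, ∏ i ∈ s, ‖∑ x, l i x * g x‖ ^ 2 ∂gaussianVector σ := by
  classical
  induction s using Finset.induction_on with
  | empty => simp
  | insert i s hi ih =>
    rw [Finset.prod_insert hi]
    simp only [Finset.prod_insert hi]
    -- The factors are peeled off one at a time; the remaining product of linear forms is the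
    -- polynomial `p`.
    have h := le_integral_linear_mul (l i) (∏ j ∈ s, ∑ x, C (l j x) * X x)
    simp only [map_prod, map_sum, map_mul, eval_C, eval_X, norm_prod, ← Finset.prod_pow] at h
    exact (mul_le_mul_of_nonneg_left ih (by positivity)).trans h

/-! ### Moments of the squared norm of a Gaussian vector -/

theorem integrable_norm_sq_eval (p : MvPolynomial σ ℂ) :
    Integrable (fun g => ‖eval g p‖ ^ 2) (gaussianVector σ) := by
  refine (integrable_eval_mul_star p p).norm.congr (Filter.Eventually.of_forall fun g => ?_)
  simp [sq]

theorem integrable_prod_linear {ι : Type*} (s : Finset ι) (l : ι → σ → ℂ) :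
    Integrable (fun g => ∏ i ∈ s, ‖∑ x, l i x * g x‖ ^ 2) (gaussianVector σ) := by
  have h := integrable_norm_sq_eval (∏ j ∈ s, ∑ x, C (l j x) * X x)
  simpa only [map_prod, map_sum, map_mul, eval_C, eval_X, norm_prod, ← Finset.prod_pow] using h

theorem integrable_norm_sq_pow_mul (j : ℕ) (p : MvPolynomial σ ℂ) :
    Integrable (fun g : σ → ℂ => (∑ x, ‖g x‖ ^ 2) ^ j * ‖eval g p‖ ^ 2) (gaussianVector σ) := by
  induction j generalizing p with
  | zero => simpa using integrable_norm_sq_eval p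
  | succ j ih =>
    have := integrable_finsetSum Finset.univ fun x _ => ih (X x * p)
    refine this.congr (Filter.Eventually.of_forall fun g => ?_)
    simp only [map_mul, eval_X, norm_mul, mul_pow, pow_succ, Finset.sum_mul, Finset.mul_sum]
    exact Finset.sum_congr rfl fun x _ => by ring

/-- The commutators contribute one per variable, and the remainder is the number operator, equal to
`k` by Euler's identity. -/
theorem sum_integral_X_mul {k : ℕ} {p : MvPolynomial σ ℂ} (hp : p.IsHomogeneous k) :
    ∑ x, ∫ g, ‖eval g (X x * p)‖ ^ 2 ∂gaussianVector σ =
      (Fintype.card σ + k) * ∫ g, ‖eval g p‖ ^ 2 ∂gaussianVector σ := by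
  classical
  have key : ∑ x, fischer (X x * p) (X x * p) = (Fintype.card σ + k) * fischer p p := by
    simp only [fischer_X_mul_X_mul, if_true, Finset.sum_add_distrib]
    have h : ∑ x, fischer (pderiv x p) (pderiv x p) = fischer (∑ x, X x * pderiv x p) p := by
      simp only [fischer_sum_left, fischer_X_mul]
    rw [h, hp.sum_X_mul_pderiv, nsmul_eq_mul, ← map_natCast (C : ℂ →+* MvPolynomial σ ℂ), fischer_C_mul_left]
    simp only [Finset.sum_const, Finset.card_univ, nsmul_eq_mul]
    ring
  simp only [fischer_self] at key
  exact_mod_cast key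

/-- A factor `‖g‖²` is traded for the polynomials `X x * p`, of degree one higher. The induction
needs a general `p`, although only `p = 1` is used later. -/
theorem integral_norm_sq_pow_mul (j k : ℕ) {p : MvPolynomial σ ℂ} (hp : p.IsHomogeneous k) :
    ∫ g : σ → ℂ, (∑ x, ‖g x‖ ^ 2) ^ j * ‖eval g p‖ ^ 2 ∂gaussianVector σ =
      (∏ i ∈ Finset.range j, ((Fintype.card σ : ℝ) + k + i)) *
        ∫ g, ‖eval g p‖ ^ 2 ∂gaussianVector σ := by
  induction j generalizing p k with
  | zero => simp
  | succ j ih =>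
    have h : ∀ g : σ → ℂ, (∑ x, ‖g x‖ ^ 2) ^ (j + 1) * ‖eval g p‖ ^ 2 =
        ∑ x, (∑ x, ‖g x‖ ^ 2) ^ j * ‖eval g (X x * p)‖ ^ 2 := by
      intro g
      simp only [map_mul, eval_X, norm_mul, mul_pow, pow_succ _ j, ← Finset.mul_sum,
        ← Finset.sum_mul]
      ring
    simp only [h]
    rw [integral_finsetSum _ fun x _ => integrable_norm_sq_pow_mul j (X x * p)]
    have hx : ∀ x : σ, (X x * p).IsHomogeneous (k + 1) := fun x => by
      simpa [add_comm] using (isHomogeneous_X ℂ x).mul hp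
    simp only [fun x => ih (k + 1) (hx x), ← Finset.mul_sum, sum_integral_X_mul hp]
    rw [Finset.prod_range_succ']
    push_cast
    simp only [add_zero, add_assoc, add_comm (1 : ℝ)]
    ring

theorem integral_norm_sq_pow (m : ℕ) :
    ∫ g : σ → ℂ, (∑ x, ‖g x‖ ^ 2) ^ m ∂gaussianVector σ =
      ∏ i ∈ Finset.range m, ((Fintype.card σ : ℝ) + i) := by
  simpa using integral_norm_sq_pow_mul (σ := σ) m 0 (isHomogeneous_one σ ℂ)

theorem integrable_norm_sq_pow (m : ℕ) :
    Integrable (fun g : σ → ℂ => (∑ x, ‖g x‖ ^ 2) ^ m) (gaussianVector σ) := by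
  simpa using integrable_norm_sq_pow_mul (σ := σ) m 1

end Fischer

/-! ### Amplitudes of rank-one measurements -/

theorem sum_sum_prod_eq_prod_sum_sum {ι R : Type*} [Fintype ι] [DecidableEq ι] [CommSemiring R]
    {α β : ι → Type*} [∀ i, Fintype (α i)] [∀ i, Fintype (β i)] (f : ∀ i, α i → β i → R) :
    ∑ c : ∀ i, α i, ∑ k : ∀ i, β i, ∏ i, f i (c i) (k i) = ∏ i, ∑ c, ∑ k, f i c k := by
  simp only [Finset.prod_univ_sum, Fintype.piFinset_univ]

theorem norm_sq_sum_mul {ι : Type*} [Fintype ι] (f : ι → ℂ) :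
    ((‖∑ y, f y‖ ^ 2 : ℝ) : ℂ) = ∑ y, ∑ y', f y * star (f y') := by
  rw [← Finset.sum_mul_sum, ← star_sum, Complex.ofReal_pow]
  exact (Complex.mul_conj' _).symm

/-- A product of rank-one measurements preserves the norm. -/
theorem sum_sum_norm_sq_prod_mul {ι : Type*} [Fintype ι] [DecidableEq ι] {α β γ : ι → Type*}
    [∀ i, Fintype (α i)] [∀ i, Fintype (β i)] [∀ i, Fintype (γ i)] [∀ i, DecidableEq (γ i)]
    (K : ∀ i, α i → β i → γ i → ℂ)
    (hK : ∀ i a b, ∑ c, ∑ k, star (K i c k a) * K i c k b = if a = b then 1 else 0)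
    (Ψ : (∀ i, γ i) → ℂ) :
    ∑ c : ∀ i, α i, ∑ k : ∀ i, β i, ‖∑ y, (∏ i, K i (c i) (k i) (y i)) * Ψ y‖ ^ 2 =
      ∑ y, ‖Ψ y‖ ^ 2 := by
  have key : ∀ y y' : ∀ i, γ i, ∑ c : ∀ i, α i, ∑ k : ∀ i, β i,
      ((∏ i, K i (c i) (k i) (y i)) * Ψ y) * star ((∏ i, K i (c i) (k i) (y' i)) * Ψ y') =
      if y = y' then Ψ y * star (Ψ y) else 0 := by
    intro y y'
    have h1 : ∀ (c : ∀ i, α i) (k : ∀ i, β i),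
        ((∏ i, K i (c i) (k i) (y i)) * Ψ y) * star ((∏ i, K i (c i) (k i) (y' i)) * Ψ y') =
          (∏ i, star (K i (c i) (k i) (y' i)) * K i (c i) (k i) (y i)) * (Ψ y * star (Ψ y')) := by
      intro c k
      rw [star_mul', star_prod, Finset.prod_mul_distrib]
      ring
    simp only [h1, ← Finset.sum_mul]
    -- The sum over joint outcomes splits into the local completeness relations.
    rw [sum_sum_prod_eq_prod_sum_sum
      (fun i c k => star (K i c k (y' i)) * K i c k (y i))]
    simp only [hK]
    split_ifs with h
    · subst h; simp
    · obtain ⟨i, hi⟩ := Function.ne_iff.1 h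
      rw [Finset.prod_eq_zero (Finset.mem_univ i) (if_neg (Ne.symm hi)), zero_mul]
  apply Complex.ofReal_injective
  simp only [Complex.ofReal_sum, norm_sq_sum_mul]
  calc _ = ∑ y, ∑ y', ∑ c : ∀ i, α i, ∑ k : ∀ i, β i,
      ((∏ i, K i (c i) (k i) (y i)) * Ψ y) * star ((∏ i, K i (c i) (k i) (y' i)) * Ψ y') := by
        simp only [Finset.sum_comm (s := (Finset.univ : Finset (∀ i, β i)))
          (t := (Finset.univ : Finset (∀ i, γ i))), Finset.sum_comm
          (s := (Finset.univ : Finset (∀ i, α i))) (t := (Finset.univ : Finset (∀ i, γ i)))]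
    _ = _ := by
        simp only [key, Finset.sum_ite_eq, Finset.mem_univ, if_true]
        refine Finset.sum_congr rfl fun y _ => ?_
        rw [Complex.ofReal_pow]
        exact Complex.mul_conj' _

/-! ### The shared entanglement is normalized -/

section Entanglement

variable {n m : ℕ} (G : SimpleGraph (Fin m)) [DecidableRel G.Adj]

/-- The registers of the entangled qubits, listed by nodes or by edges. -/
def entRegEquiv (B : Type) :
    (∀ i, {j : Fin m // G.Adj i j} → B) ≃
      ({e : Fin m × Fin m // e.1 < e.2 ∧ G.Adj e.1 e.2} → B × B) where
  toFun s e := (s e.1.1 ⟨e.1.2, e.2.2⟩, s e.1.2 ⟨e.1.1, e.2.2.symm⟩)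
  invFun f i j :=
    if h : i < j.1 then (f ⟨(i, j.1), h, j.2⟩).1
    else (f ⟨(j.1, i), lt_of_le_of_ne (not_lt.1 h) (G.ne_of_adj j.2).symm, j.2.symm⟩).2
  left_inv s := by
    funext i j
    by_cases h : i < j.1 <;> simp [h]
  right_inv f := by
    funext e
    have h := e.2.1
    simp [h, not_lt.2 h.le]

/-- Listed by edges, the squared amplitude is a product of independent factors, one normalized
bundle of Bell pairs per edge. -/
theorem sum_norm_sq_entAmplitude (E : ℕ) :
    ∑ s : ∀ i, EntReg G E i, ‖entAmplitude G E s‖ ^ 2 = 1 := by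
  have h := (entRegEquiv G (Bits E)).sum_comp
    fun f => ∏ e, ‖bellAmplitude (f e).1 (f e).2‖ ^ 2
  have h1 : ∑ b : Bits E × Bits E, ‖bellAmplitude b.1 b.2‖ ^ 2 = 1 := by
    rw [Fintype.sum_prod_type]
    simp only [bellAmplitude]
    have : ∀ x y : Bits E, ‖(if x = y then (((Real.sqrt 2)⁻¹ : ℝ) : ℂ) ^ E else 0)‖ ^ 2 =
        if x = y then ((2 : ℝ)⁻¹) ^ E else 0 := by
      intro x y
      split_ifs
      · rw [norm_pow, Complex.norm_real, ← pow_mul, mul_comm, pow_mul, Real.norm_eq_abs, sq_abs,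
          inv_pow, Real.sq_sqrt zero_le_two]
      · simp
    simp only [this, Finset.sum_ite_eq, Finset.mem_univ, if_true]
    simp
  have h2 := Finset.prod_univ_sum
    (fun _ : {e : Fin m × Fin m // e.1 < e.2 ∧ G.Adj e.1 e.2} =>
      (Finset.univ : Finset (Bits E × Bits E))) fun _ b => ‖bellAmplitude b.1 b.2‖ ^ 2
  simp only [h1, Finset.prod_const_one, Fintype.piFinset_univ] at h2
  rw [h2, ← h]
  refine Finset.sum_congr rfl fun s _ => ?_
  simp [entAmplitude, entRegEquiv, Finset.prod_pow]

end Entanglement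

/-! ### Outcome probabilities of protocols with classical messages -/

section Joint

variable {n m : ℕ} (G : SimpleGraph (Fin m)) [DecidableRel G.Adj] (E : ℕ)

/-- The amplitudes of the joint initial state, when node `i` holds the vector `φ i`. -/
noncomputable def jointAmplitude (φ : Fin m → Bits n → ℂ) (y : ∀ i, NodeReg n G E i) : ℂ :=
  (∏ i, φ i (y i).1) * entAmplitude G E fun i => (y i).2

/-- The amplitude of a joint outcome, when node `i` applies the row vector `K i`. -/
noncomputable def outcomeAmplitude (K : ∀ i, NodeReg n G E i → ℂ) (φ : Fin m → Bits n → ℂ) : ℂ :=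
  ∑ y, (∏ i, K i (y i)) * jointAmplitude G E φ y

theorem sum_norm_sq_jointAmplitude (φ : Fin m → Bits n → ℂ) :
    ∑ y, ‖jointAmplitude G E φ y‖ ^ 2 = ∏ i, ∑ x, ‖φ i x‖ ^ 2 := by
  have h : ∀ y : ∀ i, NodeReg n G E i, ‖jointAmplitude G E φ y‖ ^ 2 =
      (fun p : (Fin m → Bits n) × (∀ i, EntReg G E i) =>
        (∏ i, ‖φ i (p.1 i)‖ ^ 2) * ‖entAmplitude G E p.2‖ ^ 2)
        (Equiv.arrowProdEquivProdArrow (Fin m) (fun _ => Bits n) (EntReg G E) y) := by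
    intro y
    simp [jointAmplitude, mul_pow, Finset.prod_pow, Equiv.arrowProdEquivProdArrow]
  rw [Finset.sum_congr rfl fun y _ => h y]
  refine (Equiv.sum_comp _ fun p : (Fin m → Bits n) × (∀ i, EntReg G E i) =>
    (∏ i, ‖φ i (p.1 i)‖ ^ 2) * ‖entAmplitude G E p.2‖ ^ 2).trans ?_
  rw [Fintype.sum_prod_type]
  simp only [← Finset.mul_sum, sum_norm_sq_entAmplitude, mul_one]
  rw [Finset.prod_univ_sum, Fintype.piFinset_univ]

theorem initialState_pure (ψ : Bits n → ℂ) :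
    initialState G E (vecMulVec ψ (star ψ)) =
      vecMulVec (jointAmplitude G E fun _ => ψ) (star (jointAmplitude G E fun _ => ψ)) := by
  ext y y'
  simp only [initialState, of_apply, vecMulVec_apply, jointAmplitude, Pi.star_apply, star_mul',
    star_prod, Finset.prod_mul_distrib]
  ring

/-- The maximally mixed state is the uniform mixture of basis states, chosen independently at each
node. This is why `jointAmplitude` allows a different vector at every node. -/
theorem initialState_maximallyMixed :
    initialState G E (maximallyMixed n) =
      (((2 : ℂ) ^ n)⁻¹ ^ m) • ∑ z : Fin m → Bits n,
        vecMulVec (jointAmplitude G E fun i => Pi.single (z i) 1)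
          (star (jointAmplitude G E fun i => Pi.single (z i) 1)) := by
  ext y y'
  have h1 : ∀ x x' : Bits n, maximallyMixed n x x' =
      ((2 : ℂ) ^ n)⁻¹ * ∑ z : Bits n, (Pi.single z 1 : Bits n → ℂ) x *
        star ((Pi.single z 1 : Bits n → ℂ) x') := by
    intro x x'
    simp [maximallyMixed, Matrix.one_apply, Pi.single_apply]
  simp only [initialState, of_apply, h1, Finset.prod_mul_distrib, Finset.prod_const,
    Finset.card_univ, Fintype.card_fin]
  rw [Finset.prod_univ_sum, Fintype.piFinset_univ]
  simp only [Matrix.smul_apply, Matrix.sum_apply, vecMulVec_apply, jointAmplitude, Pi.star_apply, star_mul',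
    star_prod, Finset.prod_mul_distrib, smul_eq_mul, mul_assoc]
  congr 1
  rw [Finset.sum_mul]
  refine Finset.sum_congr rfl fun z _ => ?_
  ring

end Joint

theorem mul_vecMulVec_mul_conjTranspose_apply {α β : Type*} [Fintype β] (A : Matrix α β ℂ)
    (Ψ : β → ℂ) (d : α) :
    (A * vecMulVec Ψ (star Ψ) * Aᴴ) d d = ((‖∑ y, A d y * Ψ y‖ ^ 2 : ℝ) : ℂ) := by
  rw [mul_vecMulVec, vecMulVec_mul, ← star_mulVec, vecMulVec_apply, Pi.star_apply,
    Complex.ofReal_pow]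
  exact Complex.mul_conj' _

/-! ### Acceptance probabilities as sums of squared amplitudes -/

namespace Protocol

variable {n m : ℕ} {G : SimpleGraph (Fin m)} [DecidableRel G.Adj] {nc : ℕ} {R : Coins} {E : ℕ}
  (P : Protocol n m G nc 0 R E)

/-- The probability of the messages `c`, when node `i` holds the vector `φ i`. -/
noncomputable def messageProb (φ : Fin m → Bits n → ℂ) (r : P.Seed) (c : Fin m → Bits nc) : ℝ :=
  ∑ k : (∀ i, P.Env i), ‖outcomeAmplitude G E (fun i => P.node r i (c i) (k i) default) φ‖ ^ 2

theorem sum_messageProb (φ : Fin m → Bits n → ℂ) (r : P.Seed) :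
    ∑ c, P.messageProb φ r c = ∏ i, ∑ x, ‖φ i x‖ ^ 2 := by
  rw [← sum_norm_sq_jointAmplitude G E φ]
  refine sum_sum_norm_sq_prod_mul (fun i c k => P.node r i c k default) (fun i a b => ?_) _
  have h := congrFun (congrFun (P.node_complete r i) a) b
  simp only [Matrix.sum_apply, Matrix.mul_apply, Matrix.one_apply, conjTranspose_apply] at h
  rw [← h]
  refine Finset.sum_congr rfl fun c _ => Finset.sum_congr rfl fun k _ => ?_
  rw [Fintype.sum_subsingleton _ (default : Bits 0)]

theorem messageProb_nonneg (φ : Fin m → Bits n → ℂ) (r : P.Seed) (c : Fin m → Bits nc) :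
    0 ≤ P.messageProb φ r c :=
  Finset.sum_nonneg fun _ _ => by positivity

/-- The probability that the central node accepts the messages `c`. -/
noncomputable def acceptWeight (r : P.Seed) (c : Fin m → Bits nc) : ℝ :=
  (P.accept r c default default).re

theorem accept_apply (r : P.Seed) (c : Fin m → Bits nc) :
    P.accept r c default default = (P.acceptWeight r c : ℂ) := by
  have h := (P.accept_posSemidef r c).diag_nonneg (i := default)
  exact (Complex.eq_re_of_ofReal_le (r := 0) (by simpa using h))

theorem acceptWeight_nonneg (r : P.Seed) (c : Fin m → Bits nc) : 0 ≤ P.acceptWeight r c := by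
  have h := (P.accept_posSemidef r c).diag_nonneg (i := default)
  rw [accept_apply] at h
  exact_mod_cast h

theorem acceptWeight_le_one (r : P.Seed) (c : Fin m → Bits nc) : P.acceptWeight r c ≤ 1 := by
  have h := (P.one_sub_accept_posSemidef r c).diag_nonneg (i := default)
  rw [Matrix.sub_apply, accept_apply, one_apply_eq, ← Complex.ofReal_one, ← Complex.ofReal_sub] at h
  have : (0 : ℝ) ≤ 1 - P.acceptWeight r c := by exact_mod_cast h
  linarith

theorem trace_accept_mul (r : P.Seed) (c : Fin m → Bits nc)
    (M : Matrix (Fin m → Bits 0) (Fin m → Bits 0) ℂ) :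
    (P.accept r c * M).trace = (P.acceptWeight r c : ℂ) * M default default := by
  rw [← accept_apply]
  simp only [Matrix.trace, Matrix.diag_apply, Matrix.mul_apply]
  rw [Fintype.sum_subsingleton _ default, Fintype.sum_subsingleton _ default]

theorem messageState_pure (ψ : Bits n → ℂ) (r : P.Seed) (c : Fin m → Bits nc) :
    P.messageState (vecMulVec ψ (star ψ)) r c default default =
      (P.messageProb (fun _ => ψ) r c : ℂ) := by
  simp only [messageState, initialState_pure, Matrix.sum_apply,
    mul_vecMulVec_mul_conjTranspose_apply, messageProb, Complex.ofReal_sum]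
  rfl

theorem messageState_maximallyMixed (r : P.Seed) (c : Fin m → Bits nc) :
    P.messageState (maximallyMixed n) r c default default =
      ((((2 : ℝ) ^ n)⁻¹ ^ m * ∑ z : Fin m → Bits n,
        P.messageProb (fun i => Pi.single (z i) 1) r c : ℝ) : ℂ) := by
  simp only [messageState, initialState_maximallyMixed, Matrix.mul_smul, Matrix.smul_mul,
    Finset.mul_sum, Matrix.sum_apply, Matrix.smul_apply, Matrix.mul_sum,
    Matrix.sum_mul,
    mul_vecMulVec_mul_conjTranspose_apply, messageProb, Complex.ofReal_sum, smul_eq_mul]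
  rw [Finset.sum_comm]
  push_cast
  rfl

/-- The probability of acceptance when node `i` holds the vector `φ i`, for a given seed. -/
noncomputable def seedAcceptProb (φ : Fin m → Bits n → ℂ) (r : P.Seed) : ℝ :=
  ∑ c, P.acceptWeight r c * P.messageProb φ r c

theorem acceptProb_pure (ψ : Bits n → ℂ) :
    P.acceptProb (vecMulVec ψ (star ψ)) = ∫ r, P.seedAcceptProb (fun _ => ψ) r ∂P.coin := by
  simp only [acceptProb, trace_accept_mul, messageState_pure, ← Complex.ofReal_mul,
    ← Complex.ofReal_sum, Complex.ofReal_re, seedAcceptProb]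

theorem acceptProb_maximallyMixed :
    P.acceptProb (maximallyMixed n) = ∫ r, ((2 : ℝ) ^ n)⁻¹ ^ m * ∑ z : Fin m → Bits n,
      P.seedAcceptProb (fun i => Pi.single (z i) 1) r ∂P.coin := by
  simp only [acceptProb, trace_accept_mul, messageState_maximallyMixed, ← Complex.ofReal_mul,
    ← Complex.ofReal_sum, Complex.ofReal_re, seedAcceptProb]
  congr 1 with r
  rw [Finset.sum_comm, Finset.mul_sum]
  refine Finset.sum_congr rfl fun c _ => ?_
  rw [Finset.mul_sum, Finset.mul_sum, Finset.mul_sum]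
  refine Finset.sum_congr rfl fun z _ => ?_
  ring

end Protocol

/-! ### Lower bound without entanglement -/

section NoEntanglement

variable {n m : ℕ} {G : SimpleGraph (Fin m)} [DecidableRel G.Adj]

theorem entAmplitude_zero (s : ∀ i, EntReg G 0 i) : entAmplitude G 0 s = 1 :=
  Finset.prod_eq_one fun _ _ => by simp [bellAmplitude, eq_iff_true_of_subsingleton]

theorem outcomeAmplitude_zero (K : ∀ i, NodeReg n G 0 i → ℂ) (φ : Fin m → Bits n → ℂ) :
    outcomeAmplitude G 0 K φ = ∏ i, ∑ x, K i (x, default) * φ i x := by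
  have h : ∀ i, ∑ x, K i (x, default) * φ i x = ∑ a : NodeReg n G 0 i, K i a * φ i a.1 := by
    intro i
    rw [Fintype.sum_prod_type]
    refine Finset.sum_congr rfl fun x _ => ?_
    rw [Fintype.sum_subsingleton _ (default : EntReg G 0 i)]
  simp only [h, outcomeAmplitude, jointAmplitude, entAmplitude_zero, mul_one,
    ← Finset.prod_mul_distrib]
  rw [Finset.prod_univ_sum, Fintype.piFinset_univ]

theorem sum_norm_sq_outcomeAmplitude_single (K : ∀ i, NodeReg n G 0 i → ℂ) :
    ∑ z : Fin m → Bits n, ‖outcomeAmplitude G 0 K fun i => Pi.single (z i) 1‖ ^ 2 =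
      ∏ i, ∑ x, ‖K i (x, default)‖ ^ 2 := by
  rw [Finset.prod_univ_sum, Fintype.piFinset_univ]
  refine Finset.sum_congr rfl fun z _ => ?_
  simp [outcomeAmplitude_zero, Pi.single_apply, Finset.prod_pow]

end NoEntanglement

/-- This homogeneity carries the error bound from unit vectors to Gaussian vectors. -/
theorem outcomeAmplitude_smul {n m : ℕ} (G : SimpleGraph (Fin m)) [DecidableRel G.Adj] (E : ℕ)
    (K : ∀ i, NodeReg n G E i → ℂ) (t : ℂ) (φ : Fin m → Bits n → ℂ) :
    outcomeAmplitude G E K (fun i => t • φ i) = t ^ m * outcomeAmplitude G E K φ := by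
  simp only [outcomeAmplitude, jointAmplitude, Pi.smul_apply, smul_eq_mul, Finset.prod_mul_distrib,
    Finset.prod_const, Finset.card_univ, Fintype.card_fin, Finset.mul_sum]
  exact Finset.sum_congr rfl fun y _ => by ring

/-! ### Rejection probabilities and their Gaussian average -/

namespace Protocol

variable {n m : ℕ} {G : SimpleGraph (Fin m)} [DecidableRel G.Adj] {nc : ℕ} {R : Coins} {E : ℕ}

section Reject

variable (P : Protocol n m G nc 0 R E)

/-- The probability of rejection when node `i` holds the vector `φ i`, for a given seed. -/
noncomputable def seedRejectProb (φ : Fin m → Bits n → ℂ) (r : P.Seed) : ℝ :=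
  ∑ c, (1 - P.acceptWeight r c) * P.messageProb φ r c

theorem seedRejectProb_eq (φ : Fin m → Bits n → ℂ) (r : P.Seed) :
    P.seedRejectProb φ r = (∏ i, ∑ x, ‖φ i x‖ ^ 2) - P.seedAcceptProb φ r := by
  rw [← P.sum_messageProb φ r, seedAcceptProb, seedRejectProb, ← Finset.sum_sub_distrib]
  exact Finset.sum_congr rfl fun c _ => by ring

theorem seedRejectProb_nonneg (φ : Fin m → Bits n → ℂ) (r : P.Seed) :
    0 ≤ P.seedRejectProb φ r :=
  Finset.sum_nonneg fun c _ =>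
    mul_nonneg (sub_nonneg.2 (P.acceptWeight_le_one r c)) (P.messageProb_nonneg φ r c)

theorem seedAcceptProb_nonneg (φ : Fin m → Bits n → ℂ) (r : P.Seed) :
    0 ≤ P.seedAcceptProb φ r :=
  Finset.sum_nonneg fun c _ =>
    mul_nonneg (P.acceptWeight_nonneg r c) (P.messageProb_nonneg φ r c)

theorem seedRejectProb_le (φ : Fin m → Bits n → ℂ) (r : P.Seed) :
    P.seedRejectProb φ r ≤ ∏ i, ∑ x, ‖φ i x‖ ^ 2 := by
  have := P.seedAcceptProb_nonneg φ r
  have := P.seedRejectProb_eq φ r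
  linarith

theorem seedRejectProb_smul (t : ℂ) (φ : Fin m → Bits n → ℂ) (r : P.Seed) :
    P.seedRejectProb (fun i => t • φ i) r = (‖t‖ ^ 2) ^ m * P.seedRejectProb φ r := by
  simp only [seedRejectProb, messageProb, outcomeAmplitude_smul, norm_mul, norm_pow, mul_pow,
    Finset.mul_sum]
  refine Finset.sum_congr rfl fun c _ => Finset.sum_congr rfl fun k _ => ?_
  ring

theorem measurable_seedRejectProb :
    Measurable fun p : P.Seed × (Bits n → ℂ) => P.seedRejectProb (fun _ => p.2) p.1 := by
  have h1 : ∀ i c k a b, Measurable fun p : P.Seed × (Bits n → ℂ) => P.node p.1 i c k a b :=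
    fun i c k a b => (P.node_measurable i c k a b).comp measurable_fst
  have h2 : ∀ c a b, Measurable fun p : P.Seed × (Bits n → ℂ) => P.accept p.1 c a b :=
    fun c a b => (P.accept_measurable c a b).comp measurable_fst
  have h3 : ∀ x, Measurable fun p : P.Seed × (Bits n → ℂ) => p.2 x :=
    fun x => (measurable_pi_apply x).comp measurable_snd
  simp only [seedRejectProb, messageProb, outcomeAmplitude, jointAmplitude, acceptWeight]
  refine Finset.measurable_sum _ fun c _ => Measurable.mul
    (measurable_const.sub (Complex.measurable_re.comp (h2 c _ _))) ?_
  refine Finset.measurable_sum _ fun k _ => Measurable.pow_const (Measurable.norm ?_) 2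
  refine Finset.measurable_sum _ fun y _ => Measurable.mul
    (Finset.measurable_prod _ fun i _ => h1 _ _ _ _ _)
    ((Finset.measurable_prod _ fun i _ => h3 _).mul_const _)

theorem integrable_seedRejectProb (g : Bits n → ℂ) :
    Integrable (P.seedRejectProb fun _ => g) P.coin := by
  have hm : Measurable (P.seedRejectProb fun _ => g) :=
    P.measurable_seedRejectProb.comp (measurable_id.prodMk measurable_const)
  refine (integrable_const (∏ _i : Fin m, ∑ x, ‖g x‖ ^ 2)).mono' hm.aestronglyMeasurable
    (Filter.Eventually.of_forall fun r => ?_)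
  rw [Real.norm_of_nonneg (P.seedRejectProb_nonneg _ r)]
  exact P.seedRejectProb_le _ r

theorem measurable_seedRejectProb_left (φ : Fin m → Bits n → ℂ) :
    Measurable fun r => P.seedRejectProb φ r := by
  simp only [seedRejectProb, messageProb, outcomeAmplitude, acceptWeight]
  refine Finset.measurable_sum _ fun c _ => Measurable.mul
    (measurable_const.sub (Complex.measurable_re.comp (P.accept_measurable c _ _))) ?_
  refine Finset.measurable_sum _ fun k _ => Measurable.pow_const (Measurable.norm ?_) 2
  exact Finset.measurable_sum _ fun y _ => Measurable.mul_const
    (Finset.measurable_prod _ fun i _ => P.node_measurable _ _ _ _ _) _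

/-- The rejection probability at an unnormalized vector. -/
theorem integral_seedRejectProb_le {δ : ℝ}
    (hP : ∀ ρ : Matrix (Bits n) (Bits n) ℂ, IsPureState ρ → 1 - δ ≤ P.acceptProb ρ)
    (g : Bits n → ℂ) :
    ∫ r, P.seedRejectProb (fun _ => g) r ∂P.coin ≤ δ * (∑ x, ‖g x‖ ^ 2) ^ m := by
  have hunit : ∀ u : Bits n → ℂ, ∑ x, ‖u x‖ ^ 2 = 1 →
      ∫ r, P.seedRejectProb (fun _ => u) r ∂P.coin ≤ δ := by
    intro u hu
    have h := hP _ ⟨u, hu, rfl⟩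
    rw [acceptProb_pure] at h
    have h2 : ∀ r, P.seedAcceptProb (fun _ => u) r = 1 - P.seedRejectProb (fun _ => u) r := by
      intro r
      rw [seedRejectProb_eq, hu]
      simp
    simp only [h2] at h
    rw [integral_sub (integrable_const _) (P.integrable_seedRejectProb u)] at h
    simp only [integral_const, probReal_univ, smul_eq_mul, mul_one] at h
    linarith
  obtain ⟨t, u, hu, rfl⟩ : ∃ (t : ℂ) (u : Bits n → ℂ), ∑ x, ‖u x‖ ^ 2 = 1 ∧ g = t • u := by
    by_cases hg : ∑ x, ‖g x‖ ^ 2 = 0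
    -- The zero vector is `0` times an arbitrary unit vector.
    · refine ⟨0, Pi.single default 1, by simp [Pi.single_apply, apply_ite], ?_⟩
      rw [zero_smul]
      ext x
      have := (Finset.sum_eq_zero_iff_of_nonneg fun x _ => by positivity).1 hg x (Finset.mem_univ x)
      simpa using this
    · have hpos : 0 < ∑ x, ‖g x‖ ^ 2 :=
        lt_of_le_of_ne (Finset.sum_nonneg fun x _ => by positivity) (Ne.symm hg)
      have hs : (Real.sqrt (∑ x, ‖g x‖ ^ 2) : ℂ) ≠ 0 := by
        simpa using (Real.sqrt_pos.2 hpos).ne'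
      refine ⟨(Real.sqrt (∑ x, ‖g x‖ ^ 2) : ℂ), (Real.sqrt (∑ x, ‖g x‖ ^ 2) : ℂ)⁻¹ • g, ?_,
        by rw [smul_inv_smul₀ hs]⟩
      simp only [Pi.smul_apply, smul_eq_mul, norm_mul, mul_pow, ← Finset.mul_sum, norm_inv,
        Complex.norm_real, Real.norm_eq_abs, inv_pow, sq_abs, Real.sq_sqrt hpos.le]
      exact inv_mul_cancel₀ hg
  have h := hunit u hu
  simp only [seedRejectProb_smul, integral_const_mul, Pi.smul_apply, smul_eq_mul, norm_mul, mul_pow,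
    ← Finset.mul_sum, hu, mul_one]
  rw [mul_comm]
  exact mul_le_mul_of_nonneg_right h (by positivity)

theorem le_integral_sum_seedRejectProb {δ : ℝ} (hP : 1 - δ ≤ 1 - P.acceptProb (maximallyMixed n)) :
    (1 - δ) * ((2 : ℝ) ^ n) ^ m ≤
      ∫ r, ∑ z : Fin m → Bits n, P.seedRejectProb (fun i => Pi.single (z i) 1) r ∂P.coin := by
  have hn : ∀ z : Fin m → Bits n,
      ∏ i, ∑ x, ‖(Pi.single (z i) 1 : Bits n → ℂ) x‖ ^ 2 = 1 := by
    intro z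
    simp [Pi.single_apply, apply_ite]
  have hint : ∀ z : Fin m → Bits n,
      Integrable (P.seedRejectProb fun i => Pi.single (z i) 1) P.coin := by
    intro z
    refine (integrable_const (1 : ℝ)).mono'
      (P.measurable_seedRejectProb_left _).aestronglyMeasurable
      (Filter.Eventually.of_forall fun r => ?_)
    rw [Real.norm_of_nonneg (P.seedRejectProb_nonneg _ r), ← hn z]
    exact P.seedRejectProb_le _ r
  have h2 : ∀ (z : Fin m → Bits n) r, P.seedAcceptProb (fun i => Pi.single (z i) 1) r =
      1 - P.seedRejectProb (fun i => Pi.single (z i) 1) r := by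
    intro z r
    rw [seedRejectProb_eq, hn]
    ring
  rw [acceptProb_maximallyMixed] at hP
  simp only [h2, Finset.sum_sub_distrib] at hP
  rw [integral_const_mul, integral_sub (integrable_const _)
    (integrable_finsetSum _ fun z _ => hint z)] at hP
  simp only [integral_const, probReal_univ, smul_eq_mul, mul_one, Finset.sum_const,
    Finset.card_univ, Fintype.card_pi, Fintype.card_bool, Finset.prod_const, Fintype.card_fin,
    one_mul, nsmul_eq_mul, Nat.cast_pow, Nat.cast_ofNat, inv_pow, mul_sub] at hP
  have hd : (0 : ℝ) < ((2 : ℝ) ^ n) ^ m := by positivity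
  rw [inv_mul_cancel₀ hd.ne'] at hP
  have := mul_le_mul_of_nonneg_left hP hd.le
  rw [sub_sub_cancel, ← mul_assoc, mul_inv_cancel₀ hd.ne', one_mul] at this
  linarith

end Reject

section LowerBound

variable (P : Protocol n m G nc 0 R 0)

/-- The Gaussian inequality holds outcome by outcome and survives the nonnegative weights `1 -
acceptWeight`. It bounds pure inputs only from below, so it is applied to rejection, which must be
rare on them. -/
theorem sum_seedRejectProb_le_integral (r : P.Seed) :
    ∑ z : Fin m → Bits n, P.seedRejectProb (fun i => Pi.single (z i) 1) r ≤
      ∫ g, P.seedRejectProb (fun _ => g) r ∂gaussianVector (Bits n) := by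
  simp only [seedRejectProb, messageProb]
  rw [Finset.sum_comm]
  have hint : ∀ (c : Fin m → Bits nc) (k : ∀ i, P.Env i),
      Integrable (fun g : Bits n → ℂ => ‖outcomeAmplitude G 0
        (fun i => P.node r i (c i) (k i) default) fun _ => g‖ ^ 2) (gaussianVector (Bits n)) := by
    intro c k
    simp only [outcomeAmplitude_zero, norm_prod, ← Finset.prod_pow]
    exact integrable_prod_linear Finset.univ
      fun i x => P.node r i (c i) (k i) default (x, default)
  rw [integral_finsetSum _ fun c _ => (integrable_finsetSum _ fun k _ => hint c k).const_mul _]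
  refine Finset.sum_le_sum fun c _ => ?_
  rw [integral_const_mul, integral_finsetSum _ fun k _ => hint c k, ← Finset.mul_sum,
    Finset.sum_comm]
  refine mul_le_mul_of_nonneg_left (Finset.sum_le_sum fun k _ => ?_)
    (sub_nonneg.2 (P.acceptWeight_le_one r c))
  rw [sum_norm_sq_outcomeAmplitude_single]
  simp only [outcomeAmplitude_zero, norm_prod, ← Finset.prod_pow]
  exact prod_le_integral_prod_linear Finset.univ
    fun i x => P.node r i (c i) (k i) default (x, default)

theorem one_sub_mul_pow_le {δ : ℝ} (hP : P.TestsPureVsMixed δ) :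
    (1 - δ) * ((2 : ℝ) ^ n) ^ m ≤ δ * ∏ i ∈ Finset.range m, ((2 : ℝ) ^ n + i) := by
  have hI : Integrable (Function.uncurry fun (r : P.Seed) (g : Bits n → ℂ) =>
      P.seedRejectProb (fun _ => g) r) (P.coin.prod (gaussianVector (Bits n))) := by
    -- Rejection at `g` is at most `‖g‖ ^ (2 m)` for every seed, which is integrable and justifies
    -- Fubini.
    have h1 := ((integrable_const (μ := P.coin) (1 : ℝ)).mul_prod
      (integrable_norm_sq_pow (σ := Bits n) m))
    refine h1.mono' P.measurable_seedRejectProb.aestronglyMeasurable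
      (Filter.Eventually.of_forall fun p => ?_)
    rw [Function.uncurry, Real.norm_of_nonneg (P.seedRejectProb_nonneg _ _), one_mul]
    simpa using P.seedRejectProb_le (fun _ => p.2) p.1
  calc (1 - δ) * ((2 : ℝ) ^ n) ^ m
      ≤ ∫ r, ∑ z : Fin m → Bits n, P.seedRejectProb (fun i => Pi.single (z i) 1) r ∂P.coin :=
        P.le_integral_sum_seedRejectProb hP.2
    _ ≤ ∫ r, ∫ g, P.seedRejectProb (fun _ => g) r ∂gaussianVector (Bits n) ∂P.coin := by
        refine integral_mono_of_nonneg (Filter.Eventually.of_forall fun r =>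
          Finset.sum_nonneg fun z _ => P.seedRejectProb_nonneg _ r) hI.integral_prod_left
          (Filter.Eventually.of_forall P.sum_seedRejectProb_le_integral)
    _ = ∫ g, ∫ r, P.seedRejectProb (fun _ => g) r ∂P.coin ∂gaussianVector (Bits n) :=
        integral_integral_swap hI
    _ ≤ ∫ g : Bits n → ℂ, δ * (∑ x, ‖g x‖ ^ 2) ^ m ∂gaussianVector (Bits n) :=
        integral_mono hI.integral_prod_right ((integrable_norm_sq_pow m).const_mul δ)
          (P.integral_seedRejectProb_le hP.1)
    _ = δ * ∏ i ∈ Finset.range m, ((2 : ℝ) ^ n + i) := by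
        rw [integral_const_mul, integral_norm_sq_pow]
        simp

end LowerBound

end Protocol

theorem prod_add_le_mul_exp {d : ℝ} (hd : 0 < d) (m : ℕ) :
    ∏ i ∈ Finset.range m, (d + i) ≤ d ^ m * Real.exp ((m : ℝ) ^ 2 / d) := by
  -- Each factor is at most `d (1 + m / d)`.
  have h : ∀ i ∈ Finset.range m, d + i ≤ d * Real.exp (m / d) := by
    intro i hi
    have h1 : (i : ℝ) ≤ m := by exact_mod_cast (Finset.mem_range.1 hi).le
    have h2 := mul_le_mul_of_nonneg_left (Real.add_one_le_exp (m / d)) hd.le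
    rw [mul_add, mul_div_cancel₀ _ hd.ne'] at h2
    linarith
  refine (Finset.prod_le_prod (fun i _ => by positivity) h).trans ?_
  rw [Finset.prod_const, Finset.card_range, mul_pow, ← Real.exp_nat_mul]
  apply le_of_eq
  congr 2
  ring

theorem sqrt_log_mul_le_of_solvable {δ : ℝ} (hδ : 0 < δ) (hδ' : δ < 1 / 2) {n m nc : ℕ}
    {G : SimpleGraph (Fin m)} [DecidableRel G.Adj]
    (h : PureVsMixedSolvable δ n m G nc 0 Coins.pub 0) :
    Real.sqrt (Real.log ((1 - δ) / δ)) * (2 : ℝ) ^ ((n : ℝ) / 2) ≤ m := by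
  obtain ⟨P, hP⟩ := h
  have hd : (0 : ℝ) < 2 ^ n := by positivity
  have h1 := P.one_sub_mul_pow_le hP
  have h2 := h1.trans (mul_le_mul_of_nonneg_left (prod_add_le_mul_exp hd m) hδ.le)
  have h3 : 1 - δ ≤ δ * Real.exp ((m : ℝ) ^ 2 / 2 ^ n) := by
    have : 0 < ((2 : ℝ) ^ n) ^ m := by positivity
    refine le_of_mul_le_mul_right ?_ this
    linarith
  have h4 : Real.log ((1 - δ) / δ) ≤ (m : ℝ) ^ 2 / 2 ^ n := by
    rw [Real.log_le_iff_le_exp (div_pos (by linarith) hδ), div_le_iff₀ hδ]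
    linarith
  rw [le_div_iff₀ hd] at h4
  have h5 : (2 : ℝ) ^ ((n : ℝ) / 2) = Real.sqrt (2 ^ n) := by
    rw [Real.sqrt_eq_rpow, ← Real.rpow_natCast, ← Real.rpow_mul zero_le_two]
    congr 1
    ring
  rw [h5, ← Real.sqrt_mul' _ hd.le]
  exact Real.sqrt_le_iff.2 ⟨by positivity, h4⟩

/-! ### Characters of bit strings -/

/-- The sign `(-1) ^ (v · x)`. -/
def bitSign {n : ℕ} (v x : Bits n) : ℤ := ∏ i, if v i && x i then -1 else 1

theorem Bits.add_self {n : ℕ} (x : Bits n) : x + x = 0 := by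
  funext i
  change xor (x i) (x i) = false
  simp

theorem Bits.add_add_cancel {n : ℕ} (x y : Bits n) : x + y + y = x := by
  rw [add_assoc, Bits.add_self, add_zero]

theorem Bits.add_eq_zero_iff {n : ℕ} (x y : Bits n) : x + y = 0 ↔ x = y :=
  ⟨fun h => by rw [← Bits.add_add_cancel x y, h, zero_add], fun h => by rw [h, Bits.add_self]⟩

theorem bitSign_add_right {n : ℕ} (v x y : Bits n) :
    bitSign v (x + y) = bitSign v x * bitSign v y := by
  rw [bitSign, bitSign, bitSign, ← Finset.prod_mul_distrib]
  refine Finset.prod_congr rfl fun i _ => ?_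
  rw [Pi.add_apply]
  cases v i <;> cases x i <;> cases y i <;> decide

theorem bitSign_comm {n : ℕ} (v x : Bits n) : bitSign v x = bitSign x v := by
  simp only [bitSign, Bool.and_comm]

theorem bitSign_add_left {n : ℕ} (v w x : Bits n) :
    bitSign (v + w) x = bitSign v x * bitSign w x := by
  rw [bitSign_comm, bitSign_add_right, bitSign_comm x v, bitSign_comm x w]

theorem bitSign_zero_right {n : ℕ} (v : Bits n) : bitSign v 0 = 1 := by
  simp [bitSign]

theorem bitSign_eq_one_or {n : ℕ} (v x : Bits n) : bitSign v x = 1 ∨ bitSign v x = -1 := by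
  have h : bitSign v x * bitSign v x = 1 := by
    rw [← bitSign_add_right, Bits.add_self, bitSign_zero_right]
  exact mul_self_eq_one_iff.1 h

theorem sum_bitSign {n : ℕ} (x : Bits n) : ∑ v, bitSign v x = if x = 0 then 2 ^ n else 0 := by
  have h := Finset.prod_univ_sum (fun _ : Fin n => (Finset.univ : Finset Bool))
    fun i b => if b && x i then (-1 : ℤ) else 1
  rw [Fintype.piFinset_univ] at h
  simp only [bitSign]
  rw [← h]
  split_ifs with hx
  · subst hx
    simp
  · obtain ⟨i, hi⟩ := Function.ne_iff.1 hx
    refine Finset.prod_eq_zero (Finset.mem_univ i) ?_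
    have : x i = true := by
      cases h : x i with
      | false => exact absurd h hi
      | true => rfl
    simp [this]

/-- At most three quarters of all pairs of nonempty bit strings are orthogonal. -/
theorem sum_bitSign_indicator_le {n : ℕ} (hn : 1 ≤ n) :
    ∑ d : Bits n × Bits n, (if bitSign d.1 d.2 = 1 then (1 : ℝ) else 0) ≤
      ((2 : ℝ) ^ n * 2 ^ n) * (3 / 4) := by
  have h1 : ∀ d : Bits n × Bits n, (if bitSign d.1 d.2 = 1 then (1 : ℝ) else 0) =
      (1 + (bitSign d.1 d.2 : ℝ)) / 2 := by
    intro d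
    rcases bitSign_eq_one_or d.1 d.2 with h | h <;> simp [h]
  have h2 : ∑ d : Bits n × Bits n, (bitSign d.1 d.2 : ℝ) = 2 ^ n := by
    rw [Fintype.sum_prod_type_right]
    simp only [← Int.cast_sum, sum_bitSign]
    simp
  simp only [h1]
  rw [← Finset.sum_div, Finset.sum_add_distrib, h2]
  -- The exact fraction is `(1 + 2 ^ (-n)) / 2`; it is at most `3 / 4` precisely because `n ≥ 1`.
  have h3 : (2 : ℝ) ≤ 2 ^ n := by
    calc (2 : ℝ) = 2 ^ 1 := by norm_num
      _ ≤ 2 ^ n := pow_le_pow_right₀ one_le_two hn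
  simp
  nlinarith

/-! ### Overwriting one register -/

section Load

variable {J B : Type} [DecidableEq J]

/-- Overwrite the register in the slot `q`, if there is one. -/
def load (q : Option J) (t : B) (k : J → B) : J → B :=
  q.elim k fun j => Function.update k j t

theorem load_apply (q : Option J) (t : B) (k : J → B) (j : J) :
    load q t k j = if q = some j then t else k j := by
  cases q with
  | none => simp [load]
  | some a => simp [load, Function.update_apply, eq_comm]

/-- Exchange a value with the content of the slot `q`. -/
def loadEquiv (q : Option J) : B × (J → B) ≃ B × (J → B) :=
  Function.Involutive.toPerm (fun p => (q.elim p.1 p.2, load q p.1 p.2)) fun p => by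
    cases q <;> simp [load]

/-- Exchanging `t` with the overwritten content is a bijection, so every register content arises
exactly `card B` times. -/
theorem sum_load [Fintype J] [Fintype B] [DecidableEq B] {R : Type*} [CommSemiring R]
    (q : Option J) (f : (J → B) → R) :
    ∑ t, ∑ k, f (load q t k) = Fintype.card B * ∑ s, f s := by
  have h := Equiv.sum_comp (loadEquiv (B := B) q) fun p => f p.2
  rw [Fintype.sum_prod_type, Fintype.sum_prod_type] at h
  refine h.trans ?_
  simp

end Load

theorem sum_load_pi {ι B : Type} [Fintype ι] [DecidableEq ι] {J : ι → Type} [∀ i, Fintype (J i)]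
    [∀ i, DecidableEq (J i)] [Fintype B] [DecidableEq B] (q : ∀ i, Option (J i))
    (f : (∀ i, J i → B) → ℝ) :
    ∑ t : ι → B, ∑ k : ∀ i, J i → B, f (fun i => load (q i) (t i) (k i)) =
      (Fintype.card B : ℝ) ^ Fintype.card ι * ∑ s, f s := by
  let e : (ι → B) × (∀ i, J i → B) ≃ (ι → B) × (∀ i, J i → B) :=
    ((Equiv.arrowProdEquivProdArrow ι (fun _ => B) fun i => J i → B).symm.trans
      (Equiv.piCongrRight fun i => loadEquiv (q i))).trans
      (Equiv.arrowProdEquivProdArrow ι (fun _ => B) fun i => J i → B)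
  have h := Equiv.sum_comp e fun p => f p.2
  rw [Fintype.sum_prod_type, Fintype.sum_prod_type] at h
  refine h.trans ?_
  simp

/-! ### The Bell measurement of a node -/

section BellMeasurement

variable {n : ℕ} {J : Type} [Fintype J] [DecidableEq J]

/-- The row vector of the outcome `d` of a Bell measurement of a state with the register in slot
`q`, and the outcome `k` of a measurement of the other registers in the computational basis. -/
noncomputable def bellRow (q : Option J) (d : Bits n × Bits n) (k : J → Bits n)
    (a : Bits n × (J → Bits n)) : ℂ :=
  ((2 : ℂ) ^ n)⁻¹ * bitSign d.1 a.1 * if a.2 = load q (a.1 + d.2) k then 1 else 0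

theorem sum_load_add {R : Type*} [CommSemiring R] (q : Option J) (x : Bits n)
    (f : (J → Bits n) → R) :
    ∑ u, ∑ k, f (load q (x + u) k) = (2 : R) ^ n * ∑ s, f s := by
  refine (Equiv.sum_comp (Equiv.addLeft x) fun t => ∑ k, f (load q t k)).trans ?_
  rw [sum_load]
  simp

/-- Summing over `v` forces equal states, and summing over `u` and `k` forces equal registers; each
yields a factor `2 ^ n`. The amplitude `2 ^ (-n)` is a Bell amplitude `2 ^ (-n / 2)` times another
`2 ^ (-n / 2)`, since the entry of `k` at the overwritten slot is redundant. Without a slot, `u` is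
redundant instead, so the same normalization works. -/
theorem sum_star_bellRow_mul (q : Option J) (a b : Bits n × (J → Bits n)) :
    ∑ d, ∑ k, star (bellRow q d k a) * bellRow q d k b = if a = b then 1 else 0 := by
  obtain ⟨x, s⟩ := a
  obtain ⟨x', s'⟩ := b
  have h1 : ∀ (v u : Bits n) (k : J → Bits n),
      star (bellRow q (v, u) k (x, s)) * bellRow q (v, u) k (x', s') =
        ((2 : ℂ) ^ n)⁻¹ ^ 2 * (((bitSign v (x + x') : ℤ) : ℂ) *
          ((if s = load q (x + u) k then 1 else 0) *
            if s' = load q (x' + u) k then 1 else 0)) := by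
    intro v u k
    have h2 : star (if s = load q (x + u) k then (1 : ℂ) else 0) =
        if s = load q (x + u) k then 1 else 0 := by split_ifs <;> simp
    have h3 : star (((2 : ℂ) ^ n)⁻¹) = ((2 : ℂ) ^ n)⁻¹ := by simp
    simp only [bellRow, bitSign_add_right, star_mul', Int.cast_mul, h2, h3, star_intCast]
    ring
  rw [Fintype.sum_prod_type]
  simp only [h1, ← Finset.mul_sum]
  rw [← Finset.sum_mul, ← Int.cast_sum, sum_bitSign]
  simp only [Bits.add_eq_zero_iff]
  by_cases hx : x = x'
  · subst hx
    rw [sum_load_add q x fun t : J → Bits n =>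
      (if s = t then (1 : ℂ) else 0) * if s' = t then 1 else 0]
    simp only [ite_mul, one_mul, zero_mul, Finset.sum_ite_eq, Finset.mem_univ, if_true]
    by_cases hs : s = s'
    · subst hs
      simp
      field_simp
    · simp [hs, Ne.symm hs]
  · simp [hx]

end BellMeasurement

/-! ### Amplitudes of simultaneous Bell measurements -/

section BellOutcome

variable {n m : ℕ} {G : SimpleGraph (Fin m)} [DecidableRel G.Adj]
  (slot : ∀ i, Option {j : Fin m // G.Adj i j})

theorem outcomeAmplitude_bellRow (d : Fin m → Bits n × Bits n) (k : ∀ i, EntReg G n i)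
    (φ : Fin m → Bits n → ℂ) :
    outcomeAmplitude G n (fun i => bellRow (slot i) (d i) (k i)) φ =
      ((2 : ℂ) ^ n)⁻¹ ^ m * ∑ x : Fin m → Bits n,
        (∏ i, ((bitSign (d i).1 (x i) : ℤ) : ℂ)) * (∏ i, φ i (x i)) *
          entAmplitude G n fun i => load (slot i) (x i + (d i).2) (k i) := by
  let F : (Fin m → Bits n) → (∀ i, EntReg G n i) → ℂ := fun x s =>
    (∏ i, bellRow (slot i) (d i) (k i) (x i, s i)) * ((∏ i, φ i (x i)) * entAmplitude G n s)
  have h1 := Equiv.sum_comp (Equiv.arrowProdEquivProdArrow (Fin m) (fun _ => Bits n) (EntReg G n))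
    fun p => F p.1 p.2
  rw [Fintype.sum_prod_type] at h1
  refine h1.trans ?_
  rw [Finset.mul_sum]
  refine Finset.sum_congr rfl fun x _ => ?_
  have h2 : ∀ i, bellRow (slot i) (d i) (k i) (x i, load (slot i) (x i + (d i).2) (k i)) =
      ((2 : ℂ) ^ n)⁻¹ * bitSign (d i).1 (x i) := fun i => by simp [bellRow]
  refine (Fintype.sum_eq_single (fun i => load (slot i) (x i + (d i).2) (k i)) ?_).trans ?_
  · intro s hs
    obtain ⟨i, hi⟩ := Function.ne_iff.1 hs
    refine mul_eq_zero_of_left (Finset.prod_eq_zero (Finset.mem_univ i) ?_) _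
    simp only [bellRow, if_neg hi, mul_zero]
  · simp only [F, h2, Finset.prod_mul_distrib, Finset.prod_const, Finset.card_univ,
      Fintype.card_fin]
    ring

/-- The value does not depend on `d`: on maximally mixed inputs the Bell outcomes are uniform. For a
basis input only one term survives, and averaging over it washes out the shift by `u`. -/
theorem sum_sum_norm_sq_outcomeAmplitude_bellRow_single (d : Fin m → Bits n × Bits n) :
    ∑ z : Fin m → Bits n, ∑ k : ∀ i, EntReg G n i,
      ‖outcomeAmplitude G n (fun i => bellRow (slot i) (d i) (k i))
        fun i => Pi.single (z i) 1‖ ^ 2 = ((2 : ℝ) ^ n)⁻¹ ^ m := by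
  have h1 : ∀ (z : Fin m → Bits n) (k : ∀ i, EntReg G n i),
      ‖outcomeAmplitude G n (fun i => bellRow (slot i) (d i) (k i))
        fun i => Pi.single (z i) 1‖ ^ 2 = (((2 : ℝ) ^ n)⁻¹ ^ m) ^ 2 *
          ‖entAmplitude G n fun i => load (slot i) (z i + (d i).2) (k i)‖ ^ 2 := by
    intro z k
    have h2 : ∀ x : Fin m → Bits n, ∏ i, (Pi.single (z i) 1 : Bits n → ℂ) (x i) =
        if x = z then 1 else 0 := by
      intro x
      simp only [Pi.single_apply]
      rw [Finset.prod_ite_zero]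
      simp [funext_iff]
    have h3 : ‖∏ i, ((bitSign (d i).1 (z i) : ℤ) : ℂ)‖ = 1 := by
      rw [norm_prod]
      refine Finset.prod_eq_one fun i _ => ?_
      rcases bitSign_eq_one_or (d i).1 (z i) with h | h <;> simp [h]
    rw [outcomeAmplitude_bellRow]
    simp only [h2, mul_ite, mul_one, mul_zero, ite_mul, zero_mul, Finset.sum_ite_eq',
      Finset.mem_univ, if_true]
    rw [norm_mul, norm_mul, h3]
    simp [mul_pow]
  simp only [h1, ← Finset.mul_sum]
  have h4 := Equiv.sum_comp (Equiv.addRight fun i => (d i).2) fun z : Fin m → Bits n =>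
    ∑ k : ∀ i, EntReg G n i, ‖entAmplitude G n fun i => load (slot i) (z i) (k i)‖ ^ 2
  simp only [Equiv.coe_addRight, Pi.add_apply] at h4
  rw [h4, sum_load_pi slot fun s => ‖entAmplitude G n s‖ ^ 2, sum_norm_sq_entAmplitude]
  simp
  field_simp

variable {slot}

theorem bellAmplitude_add_add {E : ℕ} (a b w : Bits E) :
    bellAmplitude (a + w) (b + w) = bellAmplitude a b := by
  simp [bellAmplitude]

/-- A matched edge has both halves shifted equally, which preserves its Bell amplitude; the
registers of unmatched edges are not overwritten at all. -/
theorem entAmplitude_load_add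
    (hslot : ∀ i j (h : G.Adj i j), slot i = some ⟨j, h⟩ → slot j = some ⟨i, h.symm⟩)
    (t W : Fin m → Bits n) (hW : ∀ i j (h : G.Adj i j), slot i = some ⟨j, h⟩ → W i = W j)
    (k : ∀ i, EntReg G n i) :
    (entAmplitude G n fun i => load (slot i) (t i + W i) (k i)) =
      entAmplitude G n fun i => load (slot i) (t i) (k i) := by
  refine Finset.prod_congr rfl fun e _ => ?_
  simp only [load_apply]
  by_cases h : slot e.1.1 = some ⟨e.1.2, e.2.2⟩
  · rw [if_pos h, if_pos (hslot _ _ _ h), if_pos h, if_pos (hslot _ _ _ h), hW _ _ _ h,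
      bellAmplitude_add_add]
  · have h' : slot e.1.2 ≠ some ⟨e.1.1, e.2.2.symm⟩ := fun h' => h (hslot _ _ _ h')
    rw [if_neg h, if_neg h', if_neg h, if_neg h']

theorem entAmplitude_load_eq_zero
    (hslot : ∀ i j (h : G.Adj i j), slot i = some ⟨j, h⟩ → slot j = some ⟨i, h.symm⟩)
    {i j : Fin m} (h : G.Adj i j) (hij : slot i = some ⟨j, h⟩) (t : Fin m → Bits n)
    (ht : t i ≠ t j) (k : ∀ i, EntReg G n i) :
    (entAmplitude G n fun i => load (slot i) (t i) (k i)) = 0 := by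
  have hji := hslot _ _ _ hij
  rcases lt_or_gt_of_ne h.ne with hlt | hlt
  · refine Finset.prod_eq_zero (Finset.mem_univ ⟨(i, j), hlt, h⟩) ?_
    simp [load_apply, hij, hji, bellAmplitude, ht]
  · refine Finset.prod_eq_zero (Finset.mem_univ ⟨(j, i), hlt, h.symm⟩) ?_
    simp [load_apply, hij, hji, bellAmplitude, ht.symm]

/-- Equal pure states never produce an antisymmetric outcome at a matched pair of nodes. -/
theorem outcomeAmplitude_bellRow_eq_zero
    (hslot : ∀ i j (h : G.Adj i j), slot i = some ⟨j, h⟩ → slot j = some ⟨i, h.symm⟩)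
    (d : Fin m → Bits n × Bits n) (k : ∀ i, EntReg G n i) (ψ : Bits n → ℂ)
    {i j : Fin m} (h : G.Adj i j) (hij : slot i = some ⟨j, h⟩)
    (hd : bitSign ((d i).1 + (d j).1) ((d i).2 + (d j).2) ≠ 1) :
    outcomeAmplitude G n (fun i => bellRow (slot i) (d i) (k i)) (fun _ => ψ) = 0 := by
  have hji := hslot _ _ _ hij
  have hne : i ≠ j := h.ne
  set w := (d i).2 + (d j).2 with hw
  -- Where the entanglement amplitude is nonzero, `x i + u i = x j + u j`, so adding `W` exchanges
  -- `x i` and `x j`.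
  let W : Fin m → Bits n := fun a => if a = i ∨ a = j then w else 0
  have hW : ∀ a b (h : G.Adj a b), slot a = some ⟨b, h⟩ → W a = W b := by
    intro a b hab hs
    have h1 : ∀ a b (h : G.Adj a b), slot a = some ⟨b, h⟩ → a = i ∨ a = j → b = i ∨ b = j := by
      rintro a b hab hs (rfl | rfl)
      · rw [hij] at hs
        simp only [Option.some.injEq, Subtype.mk.injEq] at hs
        exact Or.inr hs.symm
      · rw [hji] at hs
        simp only [Option.some.injEq, Subtype.mk.injEq] at hs
        exact Or.inl hs.symm
    have h2 : (a = i ∨ a = j) ↔ (b = i ∨ b = j) :=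
      ⟨h1 a b hab hs, h1 b a hab.symm (hslot _ _ _ hs)⟩
    simp only [W, h2]
  have hsign : ∏ a, bitSign (d a).1 (W a) = -1 := by
    rw [← (bitSign_eq_one_or _ _).resolve_left hd, bitSign_add_left,
      ← Finset.prod_subset (Finset.subset_univ {i, j}), Finset.prod_pair hne]
    · simp [W]
    · intro a _ ha
      have : ¬ (a = i ∨ a = j) := by simpa using ha
      simp [W, this, bitSign_zero_right]
  rw [outcomeAmplitude_bellRow]
  set f : (Fin m → Bits n) → ℂ := fun x =>
    (∏ i, ((bitSign (d i).1 (x i) : ℤ) : ℂ)) * (∏ i, ψ (x i)) *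
      entAmplitude G n fun i => load (slot i) (x i + (d i).2) (k i) with hf
  -- The exchange fixes the product of the `ψ (x a)` and the entanglement, and flips the total sign
  -- by `hsign`; so the sum equals its own negative.
  have hneg : ∀ x, f (x + W) = -f x := by
    intro x
    have hent := entAmplitude_load_add hslot (fun a => x a + (d a).2) W hW k
    have hcomm : ∀ a, (x + W) a + (d a).2 = x a + (d a).2 + W a := fun a => by
      rw [Pi.add_apply, add_right_comm]
    simp only [hf, hcomm, hent]
    by_cases hx : x i + (d i).2 = x j + (d j).2
    · have hxw : x i + w = x j := by
        rw [hw, ← add_assoc, hx, Bits.add_add_cancel]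
      have hxw' : x j + w = x i := by
        rw [← hxw, Bits.add_add_cancel]
      have hψ : ∏ a, ψ ((x + W) a) = ∏ a, ψ (x a) := by
        rw [← Equiv.prod_comp (Equiv.swap i j)]
        refine Finset.prod_congr rfl fun a _ => ?_
        congr 1
        by_cases hai : a = i
        · subst hai; simp [W, hxw']
        · by_cases haj : a = j
          · subst haj; simp [W, hxw]
          · simp [W, hai, haj, Equiv.swap_apply_of_ne_of_ne hai haj]
      have hs : ∏ a, ((bitSign (d a).1 ((x + W) a) : ℤ) : ℂ) =
          -∏ a, ((bitSign (d a).1 (x a) : ℤ) : ℂ) := by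
        simp only [Pi.add_apply, bitSign_add_right, Int.cast_mul, Finset.prod_mul_distrib]
        rw [← Int.cast_prod (s := Finset.univ) (f := fun a => bitSign (d a).1 (W a)), hsign]
        simp
      rw [hψ, hs]
      ring
    · rw [entAmplitude_load_eq_zero hslot h hij (fun a => x a + (d a).2) hx k]
      simp
  have hsum : ∑ x, f x = -∑ x, f x := by
    conv_lhs => rw [← Equiv.sum_comp (Equiv.addRight W)]
    simp only [Equiv.coe_addRight, hneg, Finset.sum_neg_distrib]
  rw [self_eq_neg.1 hsum, mul_zero]

end BellOutcome

/-! ### Upper bound with shared entanglement -/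

section Matching

variable {m : ℕ} {G : SimpleGraph (Fin m)} (slot : ∀ i, Option {j : Fin m // G.Adj i j})

/-- The outcomes of all Bell measurements are symmetric at each matched pair of nodes. -/
def AllSymmetric {n : ℕ} (d : Fin m → Bits n × Bits n) : Prop :=
  ∀ i j (h : G.Adj i j), slot i = some ⟨j, h⟩ →
    bitSign ((d i).1 + (d j).1) ((d i).2 + (d j).2) = 1

/-- The smaller endpoints of the matched pairs. -/
noncomputable def lowerEnds : Finset (Fin m) := by
  classical
  exact Finset.univ.filter fun i => ∃ j, ∃ h : G.Adj i j, slot i = some ⟨j, h⟩ ∧ i < j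

/-- The partner of a node, or the node itself. -/
def partner (i : Fin m) : Fin m := (slot i).elim i fun j => j.1

variable {slot}

theorem partner_eq {i j : Fin m} {h : G.Adj i j} (hs : slot i = some ⟨j, h⟩) :
    partner slot i = j := by
  simp [partner, hs]

theorem mem_lowerEnds {i : Fin m} :
    i ∈ lowerEnds slot ↔ ∃ j, ∃ h : G.Adj i j, slot i = some ⟨j, h⟩ ∧ i < j := by
  simp [lowerEnds]

theorem partner_notMem_lowerEnds
    (hslot : ∀ i j (h : G.Adj i j), slot i = some ⟨j, h⟩ → slot j = some ⟨i, h.symm⟩)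
    {i : Fin m} (hi : i ∈ lowerEnds slot) : partner slot i ∉ lowerEnds slot := by
  obtain ⟨j, h, hs, hlt⟩ := mem_lowerEnds.1 hi
  rw [partner_eq hs, mem_lowerEnds]
  rintro ⟨j', h', hs', hlt'⟩
  rw [hslot _ _ _ hs] at hs'
  simp only [Option.some.injEq, Subtype.mk.injEq] at hs'
  subst hs'
  exact absurd hlt' hlt.asymm

open Classical in
theorem sum_allSymmetric_le {n : ℕ} (hn : 1 ≤ n)
    (hslot : ∀ i j (h : G.Adj i j), slot i = some ⟨j, h⟩ → slot j = some ⟨i, h.symm⟩) :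
    ∑ d : Fin m → Bits n × Bits n, (if AllSymmetric slot d then (1 : ℝ) else 0) ≤
      ((2 : ℝ) ^ n * 2 ^ n) ^ m * (3 / 4) ^ (lowerEnds slot).card := by
  set L := lowerEnds slot with hL
  let g : Bits n × Bits n → ℝ := fun b => if bitSign b.1 b.2 = 1 then 1 else 0
  -- This change of variables puts the sum of the two outcomes of a pair at its lower end, which
  -- makes the conditions at different pairs independent. It is an involution because partners of
  -- lower ends are not lower ends.
  let T : (Fin m → Bits n × Bits n) → Fin m → Bits n × Bits n := fun d i =>
    if i ∈ L then d i + d (partner slot i) else d i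
  have hT : Function.Involutive T := by
    intro d
    funext i
    by_cases hi : i ∈ L
    · have hp : partner slot i ∉ L := partner_notMem_lowerEnds hslot hi
      simp only [T, if_pos hi, if_neg hp]
      ext1
      · exact Bits.add_add_cancel _ _
      · exact Bits.add_add_cancel _ _
    · simp only [T, if_neg hi]
  calc ∑ d : Fin m → Bits n × Bits n, (if AllSymmetric slot d then (1 : ℝ) else 0)
      ≤ ∑ d, ∏ i, (if i ∈ L then g (T d i) else 1) := by
        refine Finset.sum_le_sum fun d _ => ?_
        split_ifs with hd
        · refine le_of_eq (Finset.prod_eq_one fun i _ => ?_).symm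
          split_ifs with hi
          · obtain ⟨j, h, hs, -⟩ := mem_lowerEnds.1 hi
            have := hd i j h hs
            simp only [g, T, if_pos hi, partner_eq hs]
            exact if_pos this
          · rfl
        · refine Finset.prod_nonneg fun i _ => ?_
          simp only [g]
          split_ifs <;> norm_num
    _ = ∑ d : Fin m → Bits n × Bits n, ∏ i, (if i ∈ L then g (d i) else 1) :=
        Equiv.sum_comp hT.toPerm fun d => ∏ i, if i ∈ L then g (d i) else 1
    _ = ∏ i, ∑ b, (if i ∈ L then g b else 1) := by
        rw [Finset.prod_univ_sum, Fintype.piFinset_univ]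
    _ ≤ ∏ i : Fin m, ((2 : ℝ) ^ n * 2 ^ n) * (if i ∈ L then 3 / 4 else 1) := by
        refine Finset.prod_le_prod (fun i _ => Finset.sum_nonneg fun b _ => ?_) fun i _ => ?_
        · simp only [g]
          split_ifs <;> norm_num
        · split_ifs
          · exact sum_bitSign_indicator_le hn
          · simp
    _ = ((2 : ℝ) ^ n * 2 ^ n) ^ m * (3 / 4) ^ L.card := by
        rw [Finset.prod_mul_distrib, Finset.prod_ite_mem]
        simp [div_pow]

/-! ### Partner choices from a matching -/

/-- The partner of each node in a matching. -/
noncomputable def matchingSlot (M : G.Subgraph) (i : Fin m) : Option {j : Fin m // G.Adj i j} := by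
  classical
  exact if h : ∃ j, M.Adj i j then some ⟨h.choose, M.adj_sub h.choose_spec⟩ else none

theorem matchingSlot_eq_some_iff {M : G.Subgraph} (hM : M.IsMatching) {i j : Fin m}
    (h : G.Adj i j) : matchingSlot M i = some ⟨j, h⟩ ↔ M.Adj i j := by
  unfold matchingSlot
  split_ifs with hex
  · simp only [Option.some.injEq, Subtype.mk.injEq]
    constructor
    · intro he
      rw [← he]
      exact hex.choose_spec
    · intro hij
      exact (hM (M.edge_vert hij)).unique hex.choose_spec hij
  · simp only [false_iff]
    exact fun hij => hex ⟨j, hij⟩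

theorem matchingSlot_symm {M : G.Subgraph} (hM : M.IsMatching) (i j : Fin m) (h : G.Adj i j)
    (hs : matchingSlot M i = some ⟨j, h⟩) : matchingSlot M j = some ⟨i, h.symm⟩ :=
  (matchingSlot_eq_some_iff hM _).2 ((matchingSlot_eq_some_iff hM _).1 hs).symm

/-- Every matched vertex is a lower end or the partner of one. -/
theorem ncard_verts_le {M : G.Subgraph} (hM : M.IsMatching) :
    M.verts.ncard ≤ 2 * (lowerEnds (matchingSlot M)).card := by
  classical
  set L := lowerEnds (matchingSlot M) with hL
  have hsub : M.verts ⊆ ((L ∪ L.image (partner (matchingSlot M)) : Finset (Fin m)) : Set _) := by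
    intro i hi
    obtain ⟨j, hij, -⟩ := hM hi
    have h1 := (matchingSlot_eq_some_iff hM (M.adj_sub hij)).2 hij
    have h2 := matchingSlot_symm hM _ _ _ h1
    rw [Finset.mem_coe, Finset.mem_union, Finset.mem_image]
    rcases lt_or_gt_of_ne (M.adj_sub hij).ne with hlt | hlt
    · exact Or.inl (mem_lowerEnds.2 ⟨j, _, h1, hlt⟩)
    · exact Or.inr ⟨j, mem_lowerEnds.2 ⟨i, _, h2, hlt⟩, partner_eq h2⟩
  calc M.verts.ncard ≤ (L ∪ L.image (partner (matchingSlot M))).card := by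
        rw [← Set.ncard_coe_finset]
        exact Set.ncard_le_ncard hsub (Finset.finite_toSet _)
    _ ≤ L.card + L.card := (Finset.card_union_le _ _).trans
        (Nat.add_le_add_left Finset.card_image_le _)
    _ = 2 * L.card := (two_mul _).symm

end Matching

/-- The two halves of a message of `2 * n` bits. -/
noncomputable def messageEquiv (n : ℕ) : Bits (2 * n) ≃ Bits n × Bits n :=
  Fintype.equivOfCardEq (by simp [two_mul, pow_add])

open Classical in
/-- Every matched node applies a Bell measurement to its copy of the state and the qubits that it
shares with its partner; the central node accepts if all pairs give symmetric outcomes. -/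
noncomputable def bellProtocol (n : ℕ) {m : ℕ} (G : SimpleGraph (Fin m)) [DecidableRel G.Adj]
    (slot : ∀ i, Option {j : Fin m // G.Adj i j}) : Protocol n m G (2 * n) 0 Coins.priv n where
  Seed := Unit
  coin := Measure.dirac ()
  seed_trivial _ := inferInstance
  Env i := EntReg G n i
  node _ i c k := Matrix.of fun _ a => bellRow (slot i) (messageEquiv n c) k a
  node_measurable _ _ _ _ _ := measurable_const
  node_complete _ i := by
    ext a b
    have h := sum_star_bellRow_mul (slot i) a b
    rw [← Equiv.sum_comp (messageEquiv n)] at h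
    simp only [Matrix.sum_apply, Matrix.mul_apply, conjTranspose_apply, of_apply, one_apply]
    rw [← h]
    refine Finset.sum_congr rfl fun c _ => Finset.sum_congr rfl fun k _ => ?_
    rw [Fintype.sum_subsingleton _ (default : Bits 0)]
  accept _ c := if AllSymmetric slot fun i => messageEquiv n (c i) then 1 else 0
  accept_measurable _ _ _ := measurable_const
  accept_posSemidef _ c := by
    split_ifs
    · exact PosSemidef.one
    · exact PosSemidef.zero
  one_sub_accept_posSemidef _ c := by
    split_ifs
    · rw [sub_self]; exact PosSemidef.zero
    · rw [sub_zero]; exact PosSemidef.one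

section BellProtocol

variable {n m : ℕ} {G : SimpleGraph (Fin m)} [DecidableRel G.Adj]
  {slot : ∀ i, Option {j : Fin m // G.Adj i j}}

open Classical in
theorem bellProtocol_acceptWeight (r : (bellProtocol n G slot).Seed)
    (c : Fin m → Bits (2 * n)) :
    (bellProtocol n G slot).acceptWeight r c =
      if AllSymmetric slot fun i => messageEquiv n (c i) then 1 else 0 := by
  simp only [Protocol.acceptWeight, bellProtocol]
  split_ifs <;> simp

theorem bellProtocol_acceptProb_pure
    (hslot : ∀ i j (h : G.Adj i j), slot i = some ⟨j, h⟩ → slot j = some ⟨i, h.symm⟩)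
    {ψ : Bits n → ℂ} (hψ : ∑ x, ‖ψ x‖ ^ 2 = 1) :
    (bellProtocol n G slot).acceptProb (vecMulVec ψ (star ψ)) = 1 := by
  have h : ∀ r, (bellProtocol n G slot).seedAcceptProb (fun _ => ψ) r = 1 := by
    intro r
    have h1 := (bellProtocol n G slot).sum_messageProb (fun _ => ψ) r
    simp only [hψ, Finset.prod_const_one] at h1
    rw [← h1, Protocol.seedAcceptProb]
    refine Finset.sum_congr rfl fun c _ => ?_
    rw [bellProtocol_acceptWeight]
    split_ifs with hc
    · rw [one_mul]
    · rw [zero_mul]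
      unfold AllSymmetric at hc
      push Not at hc
      obtain ⟨i, j, hij, hs, hd⟩ := hc
      refine (Finset.sum_eq_zero fun k _ => ?_).symm
      have := outcomeAmplitude_bellRow_eq_zero hslot (fun i => messageEquiv n (c i)) k ψ hij hs hd
      rw [show outcomeAmplitude G n (fun i => (bellProtocol n G slot).node r i (c i) (k i) default)
        (fun _ => ψ) = 0 from this]
      simp
  rw [Protocol.acceptProb_pure]
  simp [h]

theorem bellProtocol_acceptProb_maximallyMixed_le (hn : 1 ≤ n)
    (hslot : ∀ i j (h : G.Adj i j), slot i = some ⟨j, h⟩ → slot j = some ⟨i, h.symm⟩) :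
    (bellProtocol n G slot).acceptProb (maximallyMixed n) ≤ (3 / 4) ^ (lowerEnds slot).card := by
  classical
  have hu : ∀ (r : (bellProtocol n G slot).Seed) (c : Fin m → Bits (2 * n)),
      ∑ z : Fin m → Bits n,
        (bellProtocol n G slot).messageProb (fun i => Pi.single (z i) 1) r c =
          ((2 : ℝ) ^ n)⁻¹ ^ m := fun r c =>
    sum_sum_norm_sq_outcomeAmplitude_bellRow_single slot fun i => messageEquiv n (c i)
  have h : ∀ r, ((2 : ℝ) ^ n)⁻¹ ^ m * ∑ z : Fin m → Bits n,
      (bellProtocol n G slot).seedAcceptProb (fun i => Pi.single (z i) 1) r ≤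
        (3 / 4) ^ (lowerEnds slot).card := by
    intro r
    simp only [Protocol.seedAcceptProb]
    rw [Finset.sum_comm]
    simp only [← Finset.mul_sum, hu, bellProtocol_acceptWeight, ← Finset.sum_mul]
    -- By `hu` every message vector has the same probability, so acceptance is the fraction of
    -- symmetric outcome vectors.
    have h1 := sum_allSymmetric_le hn hslot
    rw [← Equiv.sum_comp (Equiv.piCongrRight fun _ => messageEquiv n)] at h1
    have hpos : (0 : ℝ) < ((2 : ℝ) ^ n * 2 ^ n) ^ m := by positivity
    have h2 := mul_le_mul_of_nonneg_left h1 (inv_nonneg.2 hpos.le)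
    rw [← mul_assoc, inv_mul_cancel₀ hpos.ne', one_mul] at h2
    refine le_trans (le_of_eq ?_) h2
    rw [mul_comm, mul_assoc, mul_comm]
    congr 1
    rw [mul_pow, mul_inv, inv_pow]
  rw [Protocol.acceptProb_maximallyMixed]
  refine (integral_mono_of_nonneg (Filter.Eventually.of_forall fun r => ?_)
    (integrable_const _) (Filter.Eventually.of_forall h)).trans ?_
  · exact mul_nonneg (by positivity)
      (Finset.sum_nonneg fun z _ => Protocol.seedAcceptProb_nonneg _ _ _)
  · simp

end BellProtocol

theorem solvable_of_matching {δ : ℝ} (hδ : 0 ≤ δ) {N n m : ℕ} (hN : (3 / 4 : ℝ) ^ N ≤ δ)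
    (hn : 1 ≤ n) {G : SimpleGraph (Fin m)} [DecidableRel G.Adj] {M : G.Subgraph}
    (hM : M.IsMatching) (hcard : 2 * N ≤ M.verts.ncard) :
    PureVsMixedSolvable δ n m G (2 * n) 0 Coins.priv n := by
  have hslot := matchingSlot_symm hM
  refine ⟨bellProtocol n G (matchingSlot M), ?_, ?_⟩
  · rintro ρ ⟨ψ, hψ, rfl⟩
    rw [bellProtocol_acceptProb_pure hslot hψ]
    linarith
  · have h1 := bellProtocol_acceptProb_maximallyMixed_le hn hslot
    have h2 : N ≤ (lowerEnds (matchingSlot M)).card := by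
      have := ncard_verts_le hM
      omega
    have h3 : (3 / 4 : ℝ) ^ (lowerEnds (matchingSlot M)).card ≤ (3 / 4) ^ N :=
      pow_le_pow_of_le_one (by norm_num) (by norm_num) h2
    linarith

theorem mainTheorem8 (δ : ℝ) (hδ : 0 < δ) (hδ' : δ < 1 / 2) :
    (∃ C : ℝ, 0 < C ∧
      ∀ n : ℕ, 1 ≤ n → ∀ nc : ℕ, 0 < nc →
        ∀ (m : ℕ) (G : SimpleGraph (Fin m)) [DecidableRel G.Adj],
          PureVsMixedSolvable δ n m G nc 0 Coins.pub 0 →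
            C * (2 : ℝ) ^ ((n : ℝ) / 2) ≤ (m : ℝ)) ∧
    (∃ m₀ : ℕ,
      ∀ n : ℕ, 1 ≤ n →
        ∀ (m : ℕ) (G : SimpleGraph (Fin m)) [DecidableRel G.Adj],
          (∃ M : G.Subgraph, M.IsMatching ∧ m₀ ≤ M.verts.ncard) →
            PureVsMixedSolvable δ n m G (2 * n) 0 Coins.priv n) := by
  constructor
  -- The logarithm is positive because `δ < 1 / 2`.
  · refine ⟨Real.sqrt (Real.log ((1 - δ) / δ)), Real.sqrt_pos.2 (Real.log_pos ?_), ?_⟩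
    · rw [lt_div_iff₀ hδ]
      linarith
    · intro n _ nc _ m G _ h
      exact sqrt_log_mul_le_of_solvable hδ hδ' h
  · obtain ⟨N, hN⟩ := exists_pow_lt_of_lt_one hδ (by norm_num : (3 / 4 : ℝ) < 1)
    -- `N` matched pairs cover `2 * N` nodes.
    refine ⟨2 * N, fun n hn m G _ ⟨M, hM, hcard⟩ => ?_⟩
    exact solvable_of_matching hδ.le hN.le hn hM hcard
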